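/- Let $\Omega\subset\mathbb R^3$ be a bounded open set. Indices range over $1,2,3$, repeated indices are summed, and $f_{,j}=\partial f/\partial x_j$. Let $\rho,\ c,\ a_{ij},\ b_{ij},\ d_{ij},\ c_{ij},\ K_{ij},\ \tilde K_{ij},\ A_{ijkl},\ B_{ijkl},\ C_{ijkl},\ \tilde C_{ijkl}$ be real functions in $L^\infty(\Omega)$, and suppose there is $\gamma>0$ such that, a.e. in $\Omega$, $\rho\ge\gamma$, $c\ge\gamma$ and $c_{ij}\xi_i\xi_j\ge\gamma\,\xi_i\xi_i$ for all $\xi\in\mathbb R^3$. Write $W_0^{1,2}(\Omega)$ for the closure of $C_c^\infty(\Omega)$ in $W^{1,2}(\Omega)$, $e_{ij}=\tfrac12(u_{i,j}+u_{j,i})$, $e'_{ij}=\tfrac12(u'_{i,j}+u'_{j,i})$ and $$2\mathcal W[(u,\tau,R),(u',\tau',R')]=A_{ijkl}e_{kl}e'_{ij}+B_{ijkl}\,(e_{ij}R'_{k,l}+e'_{ij}R_{k,l})+K_{ij}\tau_{,i}\tau'_{,j}+C_{ijkl}R_{i,j}R'_{k,l}.$$ Assume: (i) a.e. in $\Omega$: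 $A_{ijkl}=A_{jikl}=A_{klij}$, $B_{ijkl}=B_{jikl}=B_{klij}$, $C_{ijkl}=C_{jikl}=C_{klij}$, $\tilde C_{ijkl}=\tilde C_{klij}$, and $a_{ij},b_{ij},d_{ij},c_{ij},K_{ij},\tilde K_{ij}$ are symmetric in $i,j$; (ii) for a.e. $x\in\Omega$, $\tilde K_{ij}(x)\,g_ig_j+\tilde C_{ijkl}(x)\,G_{lk}G_{ij}\ge0$ for all $g\in\mathbb R^3$, $G\in\mathbb R^{3\times3}$ (the values of $\theta_{,i}$ and $M_{i,j}$); (iii) there is $c_0>0$ such that for all $u,R\in W_0^{1,2}(\Omega)^3$ and $\tau\in W_0^{1,2}(\Omega)$, $$\int_\Omega 2\mathcal W[(u,\tau,R),(u,\tau,R)]\,dx\ \ge\ c_0\int_\Omega\big(e_{ij}e_{ij}+\tau_{,i}\tau_{,i}+R_{i,j}R_{i,j}\big)\,dx .$$ Let $\mathcal H$ be the space of all $U=(u,v,\tau,\theta,R,M)$ in $W_0^{1,2}(\Omega)^3\times L^2(\Omega)^3\times W_0^{1,2}(\Omega)\times L^2(\Omega)\times W_0^{1,2}(\Omega)^3\times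 L^2(\Omega)^3$, with $$\langle U,U'\rangle=\tfrac12\int_\Omega\Big(\rho\, v_iv_i'+c\,\theta\theta'+c_{ij}M_iM'_j+2\mathcal W[(u,\tau,R),(u',\tau',R')]\Big)dx .$$ Let $\mathscr A$ be the operator on $\mathcal H$ with $\mathscr A U=V=(V^u,V^v,V^\tau,V^\theta,V^R,V^M)$ if and only if $V\in\mathcal H$, $V^u=v$, $V^\tau=\theta$, $V^R=M$ (so that $v,\theta,M$ lie in $W_0^{1,2}$) and, in the sense of distributions on $\Omega$, $$\rho V^v_i=(A_{jikl}u_{k,l}-a_{ji}\theta+B_{jikl}R_{l,k})_{,j},$$ $$cV^\theta=-a_{ij}v_{i,j}+(K_{ij}\tau_{,j}+\tilde K_{ij}\theta_{,j}-d_{ij}M_j)_{,i}-b_{ji}M_{i,j},$$ $$c_{ij}V^M_j=(B_{klji}u_{k,l}-b_{ji}\theta+C_{jikl}R_{k,l}+\tilde C_{jikl}M_{k,l})_{,j}-d_{ij}\theta_{,j};$$ its domain is the set of all $U\in\mathcal H$ for which such a $V$ exists. Then $\langle\cdot,\cdot\rangle$ is an inner product on $\mathcal H$ whose norm is equivalent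 to the usual product norm (so $\mathcal H$ is a Hilbert space), and $\mathscr A$ generates a contraction semigroup on $\mathcal H$: there is a strongly continuous semigroup $(T(t))_{t\ge0}$ of bounded linear operators on $\mathcal H$ with $\langle T(t)U,T(t)U\rangle\le\langle U,U\rangle$ for all $t\ge0$, $U\in\mathcal H$, whose infinitesimal generator (with its domain) is exactly $\mathscr A$. -/

import Mathlib

open MeasureTheory Filter Topology TopologicalSpace Distributions
open scoped NNReal ENNReal

noncomputable section

namespace ThermoIII

/-- Three-dimensional Euclidean space. -/
abbrev E3 : Type := EuclideanSpace ℝ (Fin 3)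

/-- The partial derivative of `f` in the `i`-th coordinate direction. -/
def pderiv (i : Fin 3) (f : E3 → ℝ) (x : E3) : ℝ :=
  fderiv ℝ f x (EuclideanSpace.single i 1)

/-- Lebesgue measure on `Ω`. -/
abbrev vol (Ω : Opens E3) : Measure E3 := volume.restrict (Ω : Set E3)

/-- The real space `L²(Ω)`. -/
abbrev L2 (Ω : Opens E3) : Type := Lp ℝ 2 (vol Ω)

/-- The Hilbert space `L²(Ω) × L²(Ω)³`, in which a Sobolev function `w` is recorded as the pair
`(w, ∇w)`; the norm of the pair is the usual norm of `W^{1,2}(Ω)`. -/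
abbrev Jet (Ω : Opens E3) : Type := WithLp 2 (L2 Ω × PiLp 2 (fun _ : Fin 3 => L2 Ω))

/-- The pairs `(φ, ∇φ)` with `φ` a test function on `Ω`. -/
def testJets (Ω : Opens E3) : Submodule ℝ (Jet Ω) where
  carrier := {w | ∃ φ : 𝓓(Ω, ℝ), (w.fst : E3 → ℝ) =ᵐ[vol Ω] φ ∧
    ∀ i, (w.snd i : E3 → ℝ) =ᵐ[vol Ω] pderiv i φ}
  zero_mem' := by
    refine ⟨0, ?_, fun i => ?_⟩
    · filter_upwards [Lp.coeFn_zero ℝ 2 (vol Ω)] with x hx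
      simpa using hx
    · filter_upwards [Lp.coeFn_zero ℝ 2 (vol Ω)] with x hx
      have h0 : (⇑(0 : 𝓓(Ω, ℝ)) : E3 → ℝ) = fun _ => 0 := rfl
      simpa [pderiv, h0] using hx
  add_mem' := by
    rintro v w ⟨φ, hφ, hφ'⟩ ⟨ψ, hψ, hψ'⟩
    have hd : ∀ (χ : 𝓓(Ω, ℝ)) (x : E3), DifferentiableAt ℝ χ x := fun χ x =>
      (χ.contDiff.differentiable (by simp)) x
    refine ⟨φ + ψ, ?_, fun i => ?_⟩
    · filter_upwards [Lp.coeFn_add v.fst w.fst, hφ, hψ] with x h1 h2 h3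
      rw [WithLp.add_fst, h1, Pi.add_apply, h2, h3]
      rfl
    · filter_upwards [Lp.coeFn_add (v.snd i) (w.snd i), hφ' i, hψ' i] with x h1 h2 h3
      rw [WithLp.add_snd, PiLp.add_apply, h1, Pi.add_apply, h2, h3]
      have h0 : (⇑(φ + ψ) : E3 → ℝ) = ⇑φ + ⇑ψ := rfl
      simp only [pderiv, h0, fderiv_add (hd φ x) (hd ψ x)]
      rfl
  smul_mem' := by
    rintro a v ⟨φ, hφ, hφ'⟩
    have hd : ∀ (χ : 𝓓(Ω, ℝ)) (x : E3), DifferentiableAt ℝ χ x := fun χ x =>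
      (χ.contDiff.differentiable (by simp)) x
    refine ⟨a • φ, ?_, fun i => ?_⟩
    · filter_upwards [Lp.coeFn_smul a v.fst, hφ] with x h1 h2
      rw [WithLp.smul_fst, h1, Pi.smul_apply, h2]
      rfl
    · filter_upwards [Lp.coeFn_smul a (v.snd i), hφ' i] with x h1 h2
      rw [WithLp.smul_snd, PiLp.smul_apply, h1, Pi.smul_apply, h2]
      have h0 : (⇑(a • φ) : E3 → ℝ) = a • ⇑φ := rfl
      simp only [pderiv, h0, fderiv_const_smul (hd φ x)]
      rfl

/-- The Sobolev space `W₀^{1,2}(Ω)`: the closure of the test functions in the `W^{1,2}`-norm. -/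
abbrev W0 (Ω : Opens E3) : Type := (testJets Ω).topologicalClosure

/-- The function underlying an element of `W₀^{1,2}(Ω)`. -/
def W0.fn {Ω : Opens E3} (w : W0 Ω) : L2 Ω := w.1.fst

/-- The weak partial derivative `w_{,j}` of an element of `W₀^{1,2}(Ω)`. -/
def W0.d {Ω : Opens E3} (w : W0 Ω) (j : Fin 3) : L2 Ω := w.1.snd j

/-- The space `ℋ = W₀^{1,2}(Ω)³ × L²(Ω)³ × W₀^{1,2}(Ω) × L²(Ω) × W₀^{1,2}(Ω)³ × L²(Ω)³` of
states `(u, v, τ, θ, R, M)`. Its norm is the maximum of the norms of the components. -/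
abbrev State (Ω : Opens E3) : Type :=
  (Fin 3 → W0 Ω) × (Fin 3 → L2 Ω) × W0 Ω × L2 Ω × (Fin 3 → W0 Ω) × (Fin 3 → L2 Ω)

namespace State

variable {Ω : Opens E3}

/-- The displacement. -/
def u (U : State Ω) : Fin 3 → W0 Ω := U.1
/-- The velocity. -/
def v (U : State Ω) : Fin 3 → L2 Ω := U.2.1
/-- The thermal displacement. -/
def τ (U : State Ω) : W0 Ω := U.2.2.1
/-- The temperature. -/
def θ (U : State Ω) : L2 Ω := U.2.2.2.1
/-- The microtemperature displacement. -/
def R (U : State Ω) : Fin 3 → W0 Ω := U.2.2.2.2.1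
/-- The microtemperature. -/
def M (U : State Ω) : Fin 3 → L2 Ω := U.2.2.2.2.2

end State

/-- The constitutive coefficients, as functions of the point. Here `cT` is the tensor `c_{ij}`,
`Kt` is `K̃_{ij}` and `Ct` is `C̃_{ijkl}`. -/
structure Coefficients where
  ρ : E3 → ℝ
  c : E3 → ℝ
  a : Fin 3 → Fin 3 → E3 → ℝ
  b : Fin 3 → Fin 3 → E3 → ℝ
  d : Fin 3 → Fin 3 → E3 → ℝ
  cT : Fin 3 → Fin 3 → E3 → ℝ
  K : Fin 3 → Fin 3 → E3 → ℝ
  Kt : Fin 3 → Fin 3 → E3 → ℝ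
  A : Fin 3 → Fin 3 → Fin 3 → Fin 3 → E3 → ℝ
  B : Fin 3 → Fin 3 → Fin 3 → Fin 3 → E3 → ℝ
  C : Fin 3 → Fin 3 → Fin 3 → Fin 3 → E3 → ℝ
  Ct : Fin 3 → Fin 3 → Fin 3 → Fin 3 → E3 → ℝ

/-- The strain `e_{ij} = (u_{i,j} + u_{j,i}) / 2`. -/
def strain {Ω : Opens E3} (u : Fin 3 → W0 Ω) (i j : Fin 3) (x : E3) : ℝ :=
  (1 / 2) * ((u i).d j x + (u j).d i x)

namespace Coefficients

/-- All coefficients are (measurable and) essentially bounded on `Ω`. -/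
structure Bounded (κ : Coefficients) (Ω : Opens E3) : Prop where
  ρ : MemLp κ.ρ ∞ (vol Ω)
  c : MemLp κ.c ∞ (vol Ω)
  a : ∀ i j, MemLp (κ.a i j) ∞ (vol Ω)
  b : ∀ i j, MemLp (κ.b i j) ∞ (vol Ω)
  d : ∀ i j, MemLp (κ.d i j) ∞ (vol Ω)
  cT : ∀ i j, MemLp (κ.cT i j) ∞ (vol Ω)
  K : ∀ i j, MemLp (κ.K i j) ∞ (vol Ω)
  Kt : ∀ i j, MemLp (κ.Kt i j) ∞ (vol Ω)
  A : ∀ i j k l, MemLp (κ.A i j k l) ∞ (vol Ω)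
  B : ∀ i j k l, MemLp (κ.B i j k l) ∞ (vol Ω)
  C : ∀ i j k l, MemLp (κ.C i j k l) ∞ (vol Ω)
  Ct : ∀ i j k l, MemLp (κ.Ct i j k l) ∞ (vol Ω)

/-- The symmetry relations, almost everywhere in `Ω`. -/
def Symmetric (κ : Coefficients) (Ω : Opens E3) : Prop :=
  ∀ᵐ x ∂(vol Ω), ∀ i j : Fin 3,
    κ.a i j x = κ.a j i x ∧ κ.b i j x = κ.b j i x ∧ κ.d i j x = κ.d j i x ∧
    κ.cT i j x = κ.cT j i x ∧ κ.K i j x = κ.K j i x ∧ κ.Kt i j x = κ.Kt j i x ∧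
    ∀ k l : Fin 3,
      κ.A i j k l x = κ.A j i k l x ∧ κ.A i j k l x = κ.A k l i j x ∧
      κ.B i j k l x = κ.B j i k l x ∧ κ.B i j k l x = κ.B k l i j x ∧
      κ.C i j k l x = κ.C j i k l x ∧ κ.C i j k l x = κ.C k l i j x ∧
      κ.Ct i j k l x = κ.Ct k l i j x

/-- The densities `ρ`, `c` and the tensor `c_{ij}` are (uniformly) positive on `Ω`. -/
def Positive (κ : Coefficients) (Ω : Opens E3) : Prop :=
  ∃ γ : ℝ, 0 < γ ∧ ∀ᵐ x ∂(vol Ω), γ ≤ κ.ρ x ∧ γ ≤ κ.c x ∧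
    ∀ ξ : Fin 3 → ℝ, γ * ∑ i, ξ i ^ 2 ≤ ∑ i, ∑ j, κ.cT i j x * ξ i * ξ j

/-- The dissipation inequality `K̃_{ij} θ_{,i} θ_{,j} + C̃_{ijkl} M_{l,k} M_{i,j} ≥ 0`, for all
values `g i` of `θ_{,i}` and `G i j` of `M_{i,j}`. -/
def Dissipative (κ : Coefficients) (Ω : Opens E3) : Prop :=
  ∀ᵐ x ∂(vol Ω), ∀ (g : Fin 3 → ℝ) (G : Fin 3 → Fin 3 → ℝ),
    0 ≤ (∑ i, ∑ j, κ.Kt i j x * g i * g j) +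
      ∑ i, ∑ j, ∑ k, ∑ l, κ.Ct i j k l x * G l k * G i j

/-- The density `2𝒲[(u, τ, R), (u', τ', R')]`, that is
`A_{ijkl} e_{kl} e'_{ij} + B_{ijkl} (e_{ij} R'_{k,l} + e'_{ij} R_{k,l}) + K_{ij} τ_{,i} τ'_{,j}
+ C_{ijkl} R_{i,j} R'_{k,l}`. -/
def twoW (κ : Coefficients) {Ω : Opens E3} (u : Fin 3 → W0 Ω) (τ : W0 Ω) (R : Fin 3 → W0 Ω)
    (u' : Fin 3 → W0 Ω) (τ' : W0 Ω) (R' : Fin 3 → W0 Ω) (x : E3) : ℝ :=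
  (∑ i, ∑ j, ∑ k, ∑ l,
    (κ.A i j k l x * strain u k l x * strain u' i j x
      + κ.B i j k l x * (strain u i j x * (R' k).d l x + strain u' i j x * (R k).d l x)
      + κ.C i j k l x * (R i).d j x * (R' k).d l x))
  + ∑ i, ∑ j, κ.K i j x * τ.d i x * τ'.d j x

/-- The coercivity inequality: `∫ 2𝒲[(u, τ, R), (u, τ, R)] ≥
c₀ ∫ (e_{ij} e_{ij} + τ_{,i} τ_{,i} + R_{i,j} R_{i,j})` on `W₀^{1,2}(Ω)³ × W₀^{1,2}(Ω) ×
W₀^{1,2}(Ω)³`, with a constant `c₀ > 0`. -/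
def Coercive (κ : Coefficients) (Ω : Opens E3) : Prop :=
  ∃ c₀ : ℝ, 0 < c₀ ∧ ∀ (u : Fin 3 → W0 Ω) (τ : W0 Ω) (R : Fin 3 → W0 Ω),
    c₀ * ∫ x in (Ω : Set E3), ((∑ i, ∑ j, strain u i j x ^ 2) + (∑ i, τ.d i x ^ 2)
        + ∑ i, ∑ j, (R i).d j x ^ 2)
      ≤ ∫ x in (Ω : Set E3), κ.twoW u τ R u τ R x

/-- The energy inner product on `ℋ`:
`½ ∫ (ρ v_i v'_i + c θ θ' + c_{ij} M_i M'_j + 2𝒲[(u, τ, R), (u', τ', R')])`. -/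
def energyInner (κ : Coefficients) {Ω : Opens E3} (U U' : State Ω) : ℝ :=
  (1 / 2) * ∫ x in (Ω : Set E3),
    ((∑ i, κ.ρ x * U.v i x * U'.v i x) + κ.c x * U.θ x * U'.θ x
      + (∑ i, ∑ j, κ.cT i j x * U.M i x * U'.M j x)
      + κ.twoW U.u U.τ U.R U'.u U'.τ U'.R x)

/-- The energy norm on `ℋ`. -/
def energyNorm (κ : Coefficients) {Ω : Opens E3} (U : State Ω) : ℝ :=
  √(κ.energyInner U U)

/-- `κ.OpGraph U V` says that `U` lies in the domain of the matrix operator `𝒜` and `𝒜 U = V`;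
the domain consists of all `U ∈ ℋ` for which such a `V ∈ ℋ` exists. Rows 1, 3, 5 read `V_u = v`,
`V_τ = θ`, `V_R = M`; in particular `v`, `θ`, `M` then belong to `W₀^{1,2}(Ω)`, and
`(V.u i).d j`, `V.τ.d j`, `(V.R i).d j` are `v_{i,j}`, `θ_{,j}`, `M_{i,j}`. Rows 2, 4, 6,
multiplied by `ρ`, `c`, `c_{ij}`, hold in the sense of distributions on `Ω`:
`ρ V_{v,i} = (A_{jikl} u_{k,l} - a_{ji} θ + B_{jikl} R_{l,k})_{,j}`,
`c V_θ = -a_{ij} v_{i,j} + (K_{ij} τ_{,j} + K̃_{ij} θ_{,j} - d_{ij} M_j)_{,i} - b_{ji} M_{i,j}`,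
`c_{ij} V_{M,j} = (B_{klji} u_{k,l} - b_{ji} θ + C_{jikl} R_{k,l} + C̃_{jikl} M_{k,l})_{,j}
- d_{ij} θ_{,j}`. -/
structure OpGraph (κ : Coefficients) {Ω : Opens E3} (U V : State Ω) : Prop where
  row_u : ∀ i, (V.u i).fn = U.v i
  row_v : ∀ (i : Fin 3) (φ : 𝓓(Ω, ℝ)),
    ∫ x in (Ω : Set E3), κ.ρ x * V.v i x * φ x =
      -∫ x in (Ω : Set E3), ∑ j,
        ((∑ k, ∑ l, κ.A j i k l x * (U.u k).d l x) - κ.a j i x * U.θ x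
          + ∑ k, ∑ l, κ.B j i k l x * (U.R l).d k x) * pderiv j φ x
  row_τ : V.τ.fn = U.θ
  row_θ : ∀ φ : 𝓓(Ω, ℝ),
    ∫ x in (Ω : Set E3), κ.c x * V.θ x * φ x =
      ∫ x in (Ω : Set E3),
        (-(∑ i, ∑ j, κ.a i j x * (V.u i).d j x) * φ x
          - (∑ i, ∑ j, (κ.K i j x * U.τ.d j x + κ.Kt i j x * V.τ.d j x
              - κ.d i j x * U.M j x) * pderiv i φ x)
          - (∑ i, ∑ j, κ.b j i x * (V.R i).d j x) * φ x)
  row_R : ∀ i, (V.R i).fn = U.M i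
  row_M : ∀ (i : Fin 3) (φ : 𝓓(Ω, ℝ)),
    ∫ x in (Ω : Set E3), (∑ j, κ.cT i j x * V.M j x) * φ x =
      ∫ x in (Ω : Set E3),
        (-(∑ j, ((∑ k, ∑ l, κ.B k l j i x * (U.u k).d l x) - κ.b j i x * U.θ x
              + (∑ k, ∑ l, κ.C j i k l x * (U.R k).d l x)
              + ∑ k, ∑ l, κ.Ct j i k l x * (V.R k).d l x) * pderiv j φ x)
          - (∑ j, κ.d i j x * V.τ.d j x) * φ x)

end Coefficients

/-- `b` is an inner product on the real normed space `X`, and the norm that it induces is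
equivalent to the given one. -/
structure IsEquivalentInner {X : Type*} [NormedAddCommGroup X] [NormedSpace ℝ X]
    (b : X → X → ℝ) : Prop where
  symm : ∀ x y, b x y = b y x
  add_left : ∀ x y z, b (x + y) z = b x z + b y z
  smul_left : ∀ (r : ℝ) x y, b (r • x) y = r * b x y
  equiv : ∃ m : ℝ, 0 < m ∧ ∃ M : ℝ, 0 < M ∧ ∀ x, m * ‖x‖ ^ 2 ≤ b x x ∧ b x x ≤ M * ‖x‖ ^ 2

/-- A strongly continuous one-parameter semigroup of bounded linear operators. -/
structure C0Semigroup (X : Type*) [NormedAddCommGroup X] [NormedSpace ℝ X] where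
  T : ℝ≥0 → X →L[ℝ] X
  zero : T 0 = ContinuousLinearMap.id ℝ X
  add : ∀ s t, T (s + t) = (T s).comp (T t)
  tendsto : ∀ x, Tendsto (fun t => T t x) (𝓝 0) (𝓝 x)

/-- `x` lies in the domain of the infinitesimal generator of the semigroup, and the generator
maps `x` to `y`: `(T(t) x - x) / t → y` as `t → 0+`. -/
def C0Semigroup.GenGraph {X : Type*} [NormedAddCommGroup X] [NormedSpace ℝ X]
    (S : C0Semigroup X) (x y : X) : Prop :=
  Tendsto (fun t : ℝ≥0 => (t : ℝ)⁻¹ • (S.T t x - x)) (𝓝[>] 0) (𝓝 y)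

end ThermoIII

end

/-! The theorem is Lumer–Phillips for the energy inner product. Three facts about the system are
needed.

Norm equivalence. Positivity of `ρ`, `c`, `cT` controls the velocities, and coercivity controls
strains, `∇τ` and `∇R`. Korn's inequality (`korn`, constant `1/2` because of zero boundary values)
replaces strains by full gradients, and Poincaré on the bounded set `Ω` (`exists_poincare`) recovers
the `W₀^{1,2}` norms.

Dissipativity. The distributional equations extend by density to test functions in `W₀^{1,2}`, so
they may be tested with the velocities `v`, `θ`, `M` themselves. By `power_balance` the couplings
`a`, `b`, `d` cancel, the elastic terms assemble to the stored-energy product of `𝒜U` and `U`, and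
what remains is `2⟨𝒜U, U⟩ = -∫ (K̃∇θ·∇θ + C̃∇M·∇M) ≤ 0`.

Range. In `l U - 𝒜U = F` the displacements are eliminated through `u = (v + F_u)/l` and its
analogues, which leaves one variational equation for the velocities `w` in `Vel Ω`. The same balance
makes its form coercive: the lower bound is the energy of a state with displacements `w/l` and
velocities `w`, so no strictness of the dissipation is required. Lax–Milgram then gives a solution
for every `l > 0`.

Density of the domain is automatic in a Hilbert space, from dissipativity, the range condition and
single-valuedness. Hille–Yosida (`hille_yosida`) is proved by Yosida approximation, with the
operator treated as a graph throughout.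

The predicates `IsL2Linear` and `IsL1Bilinear` are closed under sums, products and `L^∞`
multipliers, so integrability and boundedness of the long tensor integrands follow from their shape
alone. -/

noncomputable section

namespace ThermoIII

/-! ### Contraction semigroups: the Hille–Yosida theorem by Yosida approximation. -/

section HilleYosida

variable {X : Type*} [NormedAddCommGroup X] [NormedSpace ℝ X] [CompleteSpace X]

theorem exp_add_clm {P Q : X →L[ℝ] X} (h : Commute P Q) :
    NormedSpace.exp (P + Q) = NormedSpace.exp P * NormedSpace.exp Q := by
  let _ : NormedAlgebra ℚ (X →L[ℝ] X) := NormedAlgebra.restrictScalars ℚ ℝ _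
  exact NormedSpace.exp_add_of_commute h

omit [CompleteSpace X] in
theorem norm_exp_clm_le (P : X →L[ℝ] X) : ‖NormedSpace.exp P‖ ≤ Real.exp ‖P‖ := by
  have hs := Real.summable_pow_div_factorial ‖P‖
  have hterm : ∀ n : ℕ, ‖((n.factorial : ℝ)⁻¹) • P ^ n‖ ≤ ‖P‖ ^ n / n.factorial := by
    intro n
    rw [norm_smul, norm_inv, RCLike.norm_natCast, div_eq_inv_mul]
    gcongr
    -- The zeroth term is separate: on a trivial space the identity has norm `0`, so only `‖1‖ ≤ 1`
    -- is available.
    rcases n with _ | n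
    · rw [pow_zero, pow_zero]
      exact ContinuousLinearMap.norm_id_le
    · exact norm_pow_le' _ n.succ_pos
  have h1 : NormedSpace.exp P = ∑' n : ℕ, ((n.factorial : ℝ)⁻¹) • P ^ n := by
    rw [NormedSpace.exp_eq_tsum ℝ]
  rw [h1, Real.exp_eq_exp_ℝ, NormedSpace.exp_eq_tsum_div]
  exact tsum_of_norm_bounded hs.hasSum hterm

omit [CompleteSpace X] in
theorem exp_smul_one_clm (r : ℝ) :
    NormedSpace.exp (r • (1 : X →L[ℝ] X)) = Real.exp r • (1 : X →L[ℝ] X) := by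
  have h := NormedSpace.algebraMap_exp_comm (𝔸 := X →L[ℝ] X) r
  rw [Algebra.algebraMap_eq_smul_one, Algebra.algebraMap_eq_smul_one] at h
  rw [← h, Real.exp_eq_exp_ℝ]

/-- The exponential of `t (l² R - l)` is a contraction if `‖R‖ ≤ 1 / l`. -/
theorem norm_exp_yosida_le {R : X →L[ℝ] X} {l : ℝ} (hl : 0 < l) (hR : ‖R‖ ≤ l⁻¹) {t : ℝ}
    (ht : 0 ≤ t) : ‖NormedSpace.exp (t • (l ^ 2 • R - l • (1 : X →L[ℝ] X)))‖ ≤ 1 := by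
  -- The scalar part splits off as a factor `exp (-t l)`, which exactly compensates the bound `exp
  -- (t l² · l⁻¹)` for the other factor.
  have h1 : t • (l ^ 2 • R - l • (1 : X →L[ℝ] X))
      = (-(t * l)) • (1 : X →L[ℝ] X) + (t * l ^ 2) • R := by module
  rw [h1, exp_add_clm (Commute.smul_left (Commute.one_left _) _), exp_smul_one_clm, smul_mul_assoc,
    one_mul, norm_smul, Real.norm_of_nonneg (Real.exp_pos _).le]
  have h2 : ‖(t * l ^ 2) • R‖ ≤ t * l := by
    rw [norm_smul, Real.norm_of_nonneg (by positivity)]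
    calc t * l ^ 2 * ‖R‖ ≤ t * l ^ 2 * l⁻¹ := by gcongr
      _ = t * l := by field_simp
  calc Real.exp (-(t * l)) * ‖NormedSpace.exp ((t * l ^ 2) • R)‖
      ≤ Real.exp (-(t * l)) * Real.exp (t * l) := by
        gcongr
        exact (norm_exp_clm_le _).trans (Real.exp_le_exp.mpr h2)
    _ = 1 := by rw [← Real.exp_add]; simp

/-- The path `s ↦ e^{tQ} e^{s(P-Q)} x` joins `e^{tQ} x` to `e^{tP} x`. By commutation its velocity
is `e^{sP} e^{(t-s)Q} (P-Q) x`, and for `0 ≤ s ≤ t` both exponentials are contractions. -/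
theorem norm_exp_sub_exp_le {P Q : X →L[ℝ] X} (h : Commute P Q)
    (hP : ∀ t : ℝ, 0 ≤ t → ‖NormedSpace.exp (t • P)‖ ≤ 1)
    (hQ : ∀ t : ℝ, 0 ≤ t → ‖NormedSpace.exp (t • Q)‖ ≤ 1) (x : X) {t : ℝ} (ht : 0 ≤ t) :
    ‖NormedSpace.exp (t • P) x - NormedSpace.exp (t • Q) x‖ ≤ t * ‖P x - Q x‖ := by
  set f : ℝ → X := fun s => NormedSpace.exp (t • Q) (NormedSpace.exp (s • (P - Q)) x) with hf
  have hcomm : Commute Q (P - Q) := (h.symm).sub_right (Commute.refl Q)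
  have hder : ∀ s : ℝ, HasDerivAt f
      (NormedSpace.exp (t • Q) (NormedSpace.exp (s • (P - Q)) ((P - Q) x))) s := by
    intro s
    have h1 := hasDerivAt_exp_smul_const (𝕂 := ℝ) (P - Q) s
    have h2 := h1.clm_apply (hasDerivAt_const s x)
    have h3 := (NormedSpace.exp (t • Q)).hasFDerivAt.comp_hasDerivAt s h2
    simpa [hf, Function.comp_def] using h3
  have hfact : ∀ s : ℝ, NormedSpace.exp (t • Q) * NormedSpace.exp (s • (P - Q))
      = NormedSpace.exp (s • P) * NormedSpace.exp ((t - s) • Q) := by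
    intro s
    rw [← exp_add_clm ((hcomm.smul_left t).smul_right s),
      ← exp_add_clm ((h.smul_left s).smul_right (t - s))]
    congr 1
    module
  have hbound : ∀ s ∈ Set.Ico 0 t,
      ‖NormedSpace.exp (t • Q) (NormedSpace.exp (s • (P - Q)) ((P - Q) x))‖ ≤ ‖P x - Q x‖ := by
    intro s hs
    rw [← mul_apply_eq_comp, hfact s, mul_apply_eq_comp]
    calc _ ≤ 1 * ‖NormedSpace.exp ((t - s) • Q) ((P - Q) x)‖ :=
          ContinuousLinearMap.le_of_opNorm_le _ (hP s hs.1) _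
      _ ≤ 1 * (1 * ‖(P - Q) x‖) := by
          gcongr
          exact ContinuousLinearMap.le_of_opNorm_le _ (hQ _ (by linarith [hs.2])) _
      _ = ‖P x - Q x‖ := by simp
  have := norm_image_sub_le_of_norm_deriv_le_segment' (fun s _ => (hder s).hasDerivWithinAt)
    hbound t ⟨ht, le_rfl⟩
  have e1 : f t = NormedSpace.exp (t • P) x := by
    rw [hf]
    change (NormedSpace.exp (t • Q) * NormedSpace.exp (t • (P - Q))) x = _
    rw [hfact t]
    simp
  have e0 : f 0 = NormedSpace.exp (t • Q) x := by simp [hf]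
  rw [e1, e0] at this
  linarith

omit [NormedSpace ℝ X] [CompleteSpace X] in
/-- Pointwise convergence to zero of a bounded sequence of operators can be tested on a dense
set. -/
theorem tendsto_zero_of_dense {D : Set X} (hD : Dense D) {ι : Type*} {l : Filter ι}
    (f : ι → X → X) (hf : ∀ n x y, ‖f n x - f n y‖ ≤ 2 * ‖x - y‖)
    (h : ∀ x ∈ D, Tendsto (fun n => f n x) l (𝓝 0)) (x : X) :
    Tendsto (fun n => f n x) l (𝓝 0) := by
  rw [Metric.tendsto_nhds]
  intro ε hε
  obtain ⟨y, hy, hxy⟩ := Metric.dense_iff.mp hD x (ε / 4) (by positivity)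
  have hy' : ‖x - y‖ < ε / 4 := by rw [← dist_eq_norm, dist_comm]; exact hy
  filter_upwards [(Metric.tendsto_nhds.mp (h y hxy)) (ε / 2) (by positivity)] with n hn
  rw [dist_zero_right] at hn ⊢
  calc ‖f n x‖ = ‖(f n x - f n y) + f n y‖ := by simp
    _ ≤ 2 * ‖x - y‖ + ‖f n y‖ := (norm_add_le _ _).trans (by gcongr; exact hf n x y)
    _ < ε := by linarith

/-- The Hille–Yosida theorem for contraction semigroups. The operator is given by its graph `G`
and its resolvents `R l`, `l > 0`. -/
theorem hille_yosida (G : X → X → Prop) (R : ℝ → X →L[ℝ] X)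
    (hR : ∀ l : ℝ, 0 < l → ‖R l‖ ≤ l⁻¹)
    (hG : ∀ l : ℝ, 0 < l → ∀ x y, G x y ↔ R l (l • x - y) = x)
    (hdense : Dense {x | ∃ y, G x y}) :
    ∃ S : C0Semigroup X, (∀ t, ‖S.T t‖ ≤ 1) ∧ ∀ x y, S.GenGraph x y ↔ G x y := by
  set l : ℕ → ℝ := fun n => n + 1 with hl
  have lpos : ∀ n, 0 < l n := fun n => by simp only [hl]; positivity
  have linv : Tendsto (fun n => (l n)⁻¹) atTop (𝓝 0) := by
    have := tendsto_one_div_add_atTop_nhds_zero_nat (𝕜 := ℝ)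
    simpa [hl] using this
  have hRl : ∀ n x, ‖R (l n) x‖ ≤ (l n)⁻¹ * ‖x‖ := fun n x =>
    ContinuousLinearMap.le_of_opNorm_le _ (hR _ (lpos n)) x
  have hcommR : ∀ m n, Commute (R (l m)) (R (l n)) := by
    -- The resolvent identity. Using it in both orders gives `(p - q)(R_p R_q - R_q R_p) = 0`.
    have key : ∀ {p q : ℝ}, 0 < p → 0 < q → ∀ f, R q f = R p f + (p - q) • R p (R q f) := by
      intro p q hp hq f
      have h1 : G (R q f) (q • R q f - f) := (hG q hq _ _).mpr (by simp)
      have h2 := (hG p hp _ _).mp h1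
      have h3 : p • R q f - (q • R q f - f) = f + (p - q) • R q f := by module
      rw [h3, map_add, map_smul] at h2
      exact h2.symm
    intro m n
    by_cases hmn : l m = l n
    · rw [hmn]
    · ext f
      have h1 := key (lpos m) (lpos n) f
      have h2 := key (lpos n) (lpos m) f
      have h3 : (l m - l n) • (R (l m) (R (l n) f) - R (l n) (R (l m) f)) = 0 := by
        have e : (l m - l n) • (R (l m) (R (l n) f) - R (l n) (R (l m) f))
            = (R (l m) f + (l m - l n) • R (l m) (R (l n) f) - R (l n) f)
              + (R (l n) f + (l n - l m) • R (l n) (R (l m) f) - R (l m) f) := by module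
        rw [e, ← h1, ← h2]
        simp
      rcases smul_eq_zero.mp h3 with h | h
      · exact absurd (sub_eq_zero.mp h) hmn
      · exact sub_eq_zero.mp h
  -- The Yosida approximants: formally `A n = l 𝒜 R(l)` with `l = l n`, bounded operators that
  -- converge to `𝒜` on its domain.
  set A : ℕ → X →L[ℝ] X := fun n => l n ^ 2 • R (l n) - l n • (1 : X →L[ℝ] X) with hA
  have hcommA : ∀ m n, Commute (A m) (A n) := by
    intro m n
    refine Commute.sub_left ?_ ((Commute.one_left _).smul_left _)
    exact Commute.sub_right (((hcommR m n).smul_left _).smul_right _)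
      ((Commute.one_right _).smul_right _)
  set E : ℕ → ℝ → X →L[ℝ] X := fun n t => NormedSpace.exp (t • A n) with hE
  have hE1 : ∀ n t, 0 ≤ t → ‖E n t‖ ≤ 1 := fun n t ht =>
    norm_exp_yosida_le (lpos n) (hR _ (lpos n)) ht
  have hE1' : ∀ n t, 0 ≤ t → ∀ x, ‖E n t x‖ ≤ ‖x‖ := fun n t ht x => by
    simpa using ContinuousLinearMap.le_of_opNorm_le _ (hE1 n t ht) x
  have hEE : ∀ m n t, 0 ≤ t → ∀ x, ‖E m t x - E n t x‖ ≤ t * ‖A m x - A n x‖ := fun m n t ht x =>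
    norm_exp_sub_exp_le (hcommA m n) (hE1 m) (hE1 n) x ht
  have hEid : ∀ n t, 0 ≤ t → ∀ x, ‖E n t x - x‖ ≤ t * ‖A n x‖ := fun n t ht x => by
    -- Comparison with the zero generator, whose exponential is the identity.
    have := norm_exp_sub_exp_le (Commute.zero_right (A n)) (hE1 n)
      (fun t _ => by
        rw [smul_zero, NormedSpace.exp_zero]
        exact ContinuousLinearMap.norm_id_le) x ht
    simpa using this
  have hAx : ∀ n x y, G x y → A n x = l n • R (l n) y := by
    intro n x y hxy
    have h := (hG _ (lpos n) _ _).mp hxy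
    rw [map_sub, map_smul] at h
    simp only [hA, sub_apply, smul_apply, one_apply_eq_self]
    nth_rewrite 2 [← h]
    module
  -- On the domain `l R(l) x - x = R(l) y`, of norm at most `‖y‖ / l`. The maps are differences of
  -- two contractions, hence 2-Lipschitz uniformly in `n`, so density suffices.
  have hres : ∀ z, Tendsto (fun n => l n • R (l n) z - z) atTop (𝓝 0) := by
    refine tendsto_zero_of_dense hdense (fun n z => l n • R (l n) z - z) ?_ ?_
    · intro n x y
      have e : l n • R (l n) x - x - (l n • R (l n) y - y) = l n • R (l n) (x - y) - (x - y) := by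
        rw [map_sub]; module
      rw [e]
      have : ‖l n • R (l n) (x - y)‖ ≤ ‖x - y‖ := by
        rw [norm_smul, Real.norm_of_nonneg (lpos n).le]
        calc _ ≤ l n * ((l n)⁻¹ * ‖x - y‖) := 
            mul_le_mul_of_nonneg_left (hRl n _) (lpos n).le
          _ = _ := by rw [← mul_assoc, mul_inv_cancel₀ (lpos n).ne', one_mul]
      linarith [norm_sub_le (l n • R (l n) (x - y)) (x - y)]
    · rintro x ⟨y, hxy⟩
      have e : ∀ n, l n • R (l n) x - x = R (l n) y := by
        intro n
        have h := (hG _ (lpos n) _ _).mp hxy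
        rw [map_sub, map_smul] at h
        nth_rewrite 2 [← h]
        module
      simp only [e]
      refine squeeze_zero_norm (fun n => hRl n y) ?_
      simpa using linv.mul_const ‖y‖
  have hAlim : ∀ x y, G x y → Tendsto (fun n => A n x) atTop (𝓝 y) := by
    intro x y hxy
    have := (hres y).add_const y
    simp only [sub_add_cancel, zero_add] at this
    exact this.congr fun n => (hAx n x y hxy).symm
  have hcauchy : ∀ t, 0 ≤ t → ∀ x, CauchySeq (fun n => E n t x) := by
    intro t ht x
    rw [cauchySeq_iff_tendsto_dist_atTop_0]
    have hz := tendsto_zero_of_dense hdense (l := (atTop : Filter (ℕ × ℕ)))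
      (fun p z => E p.1 t z - E p.2 t z) ?_ ?_ x
    · simpa [dist_eq_norm] using hz.norm
    · intro p x y
      have e : E p.1 t x - E p.2 t x - (E p.1 t y - E p.2 t y)
          = E p.1 t (x - y) - E p.2 t (x - y) := by rw [map_sub, map_sub]; module
      rw [e]
      linarith [norm_sub_le (E p.1 t (x - y)) (E p.2 t (x - y)), hE1' p.1 t ht (x - y),
        hE1' p.2 t ht (x - y)]
    · rintro x ⟨y, hxy⟩
      have hc := (hAlim x y hxy).cauchySeq
      rw [cauchySeq_iff_tendsto_dist_atTop_0] at hc
      refine squeeze_zero_norm (fun p => hEE p.1 p.2 t ht x) ?_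
      simpa [dist_eq_norm] using hc.const_mul t
  have hlim : ∀ (t : ℝ≥0) (x : X), ∃ z, Tendsto (fun n => E n t x) atTop (𝓝 z) := fun t x =>
    cauchySeq_tendsto_of_complete (hcauchy t t.2 x)
  choose T₀ hT₀ using hlim
  set T : ℝ≥0 → X →L[ℝ] X := fun t =>
    LinearMap.mkContinuous
      (linearMapOfTendsto (T₀ t) (fun n => (E n t).toLinearMap) (tendsto_pi_nhds.mpr (hT₀ t))) 1
      (fun x => le_of_tendsto (hT₀ t x).norm (Eventually.of_forall fun n => by
        simpa using hE1' n t t.2 x)) with hTdef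
  have hT : ∀ (t : ℝ≥0) x, Tendsto (fun n => E n t x) atTop (𝓝 (T t x)) := hT₀
  have hTn : ∀ t, ‖T t‖ ≤ 1 := fun t => LinearMap.mkContinuous_norm_le _ zero_le_one _
  have hTn' : ∀ t x, ‖T t x‖ ≤ ‖x‖ := fun t x => by
    simpa using ContinuousLinearMap.le_of_opNorm_le _ (hTn t) x
  -- Letting `m → ∞` in `hEE` keeps the factor `t`; dividing by `t` therefore gives an error uniform
  -- in `t`, which is what identifies the generator.
  have hTE : ∀ x y, G x y → ∀ n (t : ℝ≥0), ‖T t x - E n t x‖ ≤ t * ‖y - A n x‖ := by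
    intro x y hxy n t
    exact le_of_tendsto_of_tendsto ((hT t x).sub_const _).norm
      (((hAlim x y hxy).sub_const _).norm.const_mul _)
      (Eventually.of_forall fun m => hEE m n t t.2 x)
  have hTid : ∀ x y, G x y → ∀ t : ℝ≥0, ‖T t x - x‖ ≤ t * ‖y‖ := by
    intro x y hxy t
    exact le_of_tendsto_of_tendsto ((hT t x).sub_const _).norm
      ((hAlim x y hxy).norm.const_mul _)
      (Eventually.of_forall fun m => hEid m t t.2 x)
  let S : C0Semigroup X :=
    { T := T
      zero := by
        ext x
        refine tendsto_nhds_unique (hT 0 x) ?_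
        simp [hE, NormedSpace.exp_zero]
      add := by
        intro s t
        ext x
        refine tendsto_nhds_unique (hT (s + t) x) ?_
        -- The first summand tends to zero because the `E n s` are contractions uniformly in `n`;
        -- the second converges by definition of `T s`.
        have h1 : ∀ n, E n ↑(s + t) x = E n s (E n t x - T t x) + E n s (T t x) := by
          intro n
          rw [← map_add, sub_add_cancel]
          have : E n ↑(s + t) = E n s * E n t := by
            simp only [hE, NNReal.coe_add, add_smul]
            exact exp_add_clm (((Commute.refl (A n)).smul_left _).smul_right _)
          rw [this, mul_apply_eq_comp]
        simp only [h1]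
        have h2 : Tendsto (fun n => E n s (E n t x - T t x)) atTop (𝓝 0) := by
          refine squeeze_zero_norm (fun n => hE1' n s s.2 _) ?_
          simpa using ((hT t x).sub_const (T t x)).norm
        simpa using h2.add (hT s (T t x))
      tendsto := by
        intro x
        have hz := tendsto_zero_of_dense hdense (l := 𝓝 (0 : ℝ≥0)) (fun t z => T t z - z) ?_ ?_ x
        · simpa using hz.add_const x
        · intro t x y
          have e : T t x - x - (T t y - y) = T t (x - y) - (x - y) := by rw [map_sub]; module
          rw [e]
          linarith [norm_sub_le (T t (x - y)) (x - y), hTn' t (x - y)]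
        · rintro x ⟨y, hxy⟩
          refine squeeze_zero_norm (hTid x y hxy) ?_
          have : Tendsto (fun t : ℝ≥0 => (t : ℝ) * ‖y‖) (𝓝 0) (𝓝 (((0 : ℝ≥0) : ℝ) * ‖y‖)) :=
            (NNReal.continuous_coe.tendsto 0).mul_const _
          simpa using this }
  have hgen : ∀ x y, G x y → S.GenGraph x y := by
    intro x y hxy
    rw [C0Semigroup.GenGraph, Metric.tendsto_nhds]
    intro ε hε
    -- The index `n` is fixed before `t → 0`. The error then splits into three parts below `ε / 4`:
    -- `T` against `E n`, the difference quotient of `E n` against `A n x`, and `A n x` against `y`.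
    obtain ⟨n, hn⟩ := ((Metric.tendsto_nhds.mp (hAlim x y hxy)) (ε / 4) (by positivity)).exists
    rw [dist_eq_norm] at hn
    have hn' : ‖y - A n x‖ < ε / 4 := by rwa [norm_sub_rev]
    have hder : HasDerivAt (fun t : ℝ => E n t x) (A n x) 0 := by
      have h1 := hasDerivAt_exp_smul_const (𝕂 := ℝ) (A n) (0 : ℝ)
      simpa [NormedSpace.exp_zero] using h1.clm_apply (hasDerivAt_const (0 : ℝ) x)
    have hsl := hder.tendsto_slope_zero_right
    have hcoe : Tendsto (fun t : ℝ≥0 => (t : ℝ)) (𝓝[>] 0) (𝓝[>] 0) := by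
      refine tendsto_nhdsWithin_iff.mpr ⟨?_, ?_⟩
      · exact (NNReal.continuous_coe.tendsto 0).mono_left nhdsWithin_le_nhds
      · filter_upwards [self_mem_nhdsWithin] with t ht
        exact NNReal.coe_pos.mpr ht
    have hsl' := Metric.tendsto_nhds.mp (hsl.comp hcoe) (ε / 4) (by positivity)
    filter_upwards [hsl', self_mem_nhdsWithin] with t ht htpos
    have htpos' : (0 : ℝ) < t := NNReal.coe_pos.mpr htpos
    rw [dist_eq_norm] at ht ⊢
    have hE0 : E n 0 x = x := by simp [hE, NormedSpace.exp_zero]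
    simp only [Function.comp_apply, zero_add, hE0] at ht
    have e : (t : ℝ)⁻¹ • (T t x - x) - y = (t : ℝ)⁻¹ • (T t x - E n t x)
        + ((t : ℝ)⁻¹ • (E n t x - x) - A n x) + (A n x - y) := by module
    have h3 : ‖(t : ℝ)⁻¹ • (T t x - E n t x)‖ ≤ ‖y - A n x‖ := by
      rw [norm_smul, Real.norm_of_nonneg (by positivity)]
      calc _ ≤ (t : ℝ)⁻¹ * (t * ‖y - A n x‖) := by gcongr; exact hTE x y hxy n t
        _ = _ := by field_simp
    change ‖(t : ℝ)⁻¹ • (T t x - x) - y‖ < ε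
    rw [e]
    refine (norm_add₃_le).trans_lt ?_
    linarith
  refine ⟨S, hTn, fun x y => ⟨fun hxy => ?_, hgen x y⟩⟩
  -- For the converse inclusion, `z` solves `z - 𝒜z = x - y`. Since the generator extends `G`, the
  -- difference `x - z` is an eigenvector of the generator for the eigenvalue `1`, unless it
  -- vanishes.
  set z := R 1 (x - y) with hz
  have hGz : G z (z - (x - y)) := (hG 1 one_pos _ _).mpr (by simp [hz])
  have hw : S.GenGraph (x - z) (x - z) := by
    have h1 := hxy.sub (hgen _ _ hGz)
    have e : y - (z - (x - y)) = x - z := by module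
    rw [e] at h1
    refine h1.congr fun t => ?_
    rw [map_sub]
    module
  have hw0 : x - z = 0 := by
    by_contra hne
    have hpos : 0 < ‖x - z‖ := norm_pos_iff.mpr hne
    have h1 := Metric.tendsto_nhds.mp hw ‖x - z‖ hpos
    obtain ⟨t, ht, htpos⟩ := (h1.and self_mem_nhdsWithin).exists
    have htpos' : (0 : ℝ) < t := NNReal.coe_pos.mpr htpos
    rw [dist_eq_norm] at ht
    -- With `w = x - z` and small `t`, this writes `(1 + t) w` as a vector of norm at most `‖w‖`
    -- minus one of norm less than `t ‖w‖`, which is absurd.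
    have e : (1 + (t : ℝ)) • (x - z) = T t (x - z)
        - (t : ℝ) • ((t : ℝ)⁻¹ • (T t (x - z) - (x - z)) - (x - z)) := by
      rw [smul_sub (t : ℝ) ((t : ℝ)⁻¹ • _), smul_smul, mul_inv_cancel₀ htpos'.ne']
      module
    have h2 : ‖(1 + (t : ℝ)) • (x - z)‖ < (1 + t) * ‖x - z‖ := by
      rw [e]
      refine (norm_sub_le _ _).trans_lt ?_
      rw [norm_smul, Real.norm_of_nonneg htpos'.le]
      have h3 := mul_lt_mul_of_pos_left ht htpos'
      change (t : ℝ) * ‖(t : ℝ)⁻¹ • (T t (x - z) - (x - z)) - (x - z)‖ < _ at h3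
      linarith [hTn' t (x - z)]
    rw [norm_smul, Real.norm_of_nonneg (by positivity)] at h2
    exact lt_irrefl _ h2
  have hxz : x = z := sub_eq_zero.mp hw0
  rw [← hxz] at hGz
  simpa using hGz

end HilleYosida

/-! ### Equivalent inner products, Lax–Milgram and Lumer–Phillips. -/

section Renorming

variable {X : Type*} [NormedAddCommGroup X] [NormedSpace ℝ X]

/-- The space `X` with the norm induced by an equivalent inner product `b`. -/
def Renormed {b : X → X → ℝ} (_h : IsEquivalentInner b) : Type _ := X

namespace Renormed

variable {b : X → X → ℝ} (h : IsEquivalentInner b)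

instance : AddCommGroup (Renormed h) := inferInstanceAs (AddCommGroup X)

instance : Module ℝ (Renormed h) := inferInstanceAs (Module ℝ X)

/-- The inner product `b` on the renormed space. -/
@[reducible] def core : InnerProductSpace.Core ℝ (Renormed h) where
  inner := fun x y => b x y
  conj_inner_symm := fun x y => h.symm y x
  re_inner_nonneg := fun x => by
    obtain ⟨m, hm, _, _, hb⟩ := h.equiv
    exact (by positivity : 0 ≤ m * ‖(show X from x)‖ ^ 2).trans (hb x).1
  add_left := h.add_left
  smul_left := fun x y r => h.smul_left r x y
  definite := fun x hx => by
    obtain ⟨m, hm, _, _, hb⟩ := h.equiv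
    have h1 := (hb x).1
    have h2 : b x x = 0 := hx
    rw [h2] at h1
    have h3 : ‖(show X from x)‖ ^ 2 ≤ 0 := by
      by_contra hc
      exact absurd h1 (not_le.mpr (mul_pos hm (not_le.mp hc)))
    have h4 : ‖(show X from x)‖ = 0 := by
      nlinarith [norm_nonneg (show X from x)]
    exact norm_eq_zero.mp h4

instance : NormedAddCommGroup (Renormed h) :=
  @InnerProductSpace.Core.toNormedAddCommGroup ℝ (Renormed h) _ _ _ (core h)

instance : InnerProductSpace ℝ (Renormed h) := InnerProductSpace.ofCore (core h).toCore

theorem inner_eq (x y : Renormed h) : inner ℝ x y = b x y := rfl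

theorem norm_sq (x : Renormed h) : ‖x‖ ^ 2 = b x x := by
  rw [← real_inner_self_eq_norm_sq, inner_eq]

/-- The identity map, as an isomorphism of normed spaces. -/
def equiv : X ≃L[ℝ] Renormed h :=
  LinearEquiv.toContinuousLinearEquivOfBounds
    (show X ≃ₗ[ℝ] Renormed h from LinearEquiv.refl ℝ X)
    (√(h.equiv.choose_spec.2.choose)) (√(h.equiv.choose)⁻¹)
    (fun x => by
      have hM := h.equiv.choose_spec.2.choose_spec
      refine abs_le_of_sq_le_sq' ?_ (by positivity) |>.2
      rw [mul_pow, Real.sq_sqrt hM.1.le, norm_sq]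
      exact (hM.2 x).2)
    (fun x => by
      have hM := h.equiv.choose_spec.2.choose_spec
      have hm := h.equiv.choose_spec.1
      refine abs_le_of_sq_le_sq' ?_ (by positivity) |>.2
      rw [mul_pow, Real.sq_sqrt (inv_pos.mpr hm).le, norm_sq, ← div_eq_inv_mul, le_div_iff₀ hm,
        mul_comm]
      exact (hM.2 x).1)

instance [CompleteSpace X] : CompleteSpace (Renormed h) :=
  (completeSpace_congr (e := (equiv h).toEquiv) (equiv h).isUniformEmbedding).mp inferInstance

end Renormed

/-- The Lax–Milgram theorem on a Banach space whose norm is equivalent to a Hilbert norm. -/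
theorem exists_forall_bilin_eq [CompleteSpace X] {b : X → X → ℝ} (h : IsEquivalentInner b)
    (B : X →L[ℝ] X →L[ℝ] ℝ) {m : ℝ} (hm : 0 < m) (hB : ∀ x, m * ‖x‖ ^ 2 ≤ B x x)
    (ℓ : X →L[ℝ] ℝ) : ∃ x, ∀ y, B x y = ℓ y := by
  set e := Renormed.equiv h
  set B' : Renormed h →L[ℝ] Renormed h →L[ℝ] ℝ :=
    B.bilinearComp (e.symm : Renormed h →L[ℝ] X) (e.symm : Renormed h →L[ℝ] X) with hB'
  have hco : IsCoercive B' := by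
    obtain ⟨_, _, M, hM, hb⟩ := h.equiv
    -- The energy norm satisfies `‖x‖_b² ≤ M ‖x‖²`, so coercivity loses the factor `M` when measured
    -- in it.
    refine ⟨m / M, by positivity, fun x => ?_⟩
    have h1 := hB (e.symm x)
    have h2 := (hb (e.symm x)).2
    have h3 : ‖x‖ * ‖x‖ = b (e.symm x) (e.symm x) := by rw [← sq, Renormed.norm_sq]; rfl
    rw [mul_assoc, h3]
    calc m / M * b (e.symm x) (e.symm x) ≤ m / M * (M * ‖e.symm x‖ ^ 2) := by gcongr
      _ = m * ‖e.symm x‖ ^ 2 := by field_simp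
      _ ≤ B' x x := by simpa [hB'] using h1
  set f := (InnerProductSpace.toDual ℝ (Renormed h)).symm
    (ℓ.comp (e.symm : Renormed h →L[ℝ] X)) with hf
  refine ⟨e.symm (hco.continuousLinearEquivOfBilin.symm f), fun y => ?_⟩
  have h1 := hco.continuousLinearEquivOfBilin_apply (hco.continuousLinearEquivOfBilin.symm f) (e y)
  rw [ContinuousLinearEquiv.apply_symm_apply, hf, InnerProductSpace.toDual_symm_apply] at h1
  simpa [hB'] using h1.symm

/-- Transport of a semigroup along an isomorphism. -/
def C0Semigroup.conj {Y : Type*} [NormedAddCommGroup Y] [NormedSpace ℝ Y] (S : C0Semigroup Y)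
    (e : X ≃L[ℝ] Y) : C0Semigroup X where
  T := fun t => (e.symm : Y →L[ℝ] X).comp ((S.T t).comp (e : X →L[ℝ] Y))
  zero := by ext x; simp [S.zero]
  add := fun s t => by ext x; simp [S.add]
  tendsto := fun x => by
    simpa [Function.comp_def] using (e.symm.continuous.tendsto (e x)).comp (S.tendsto (e x))

theorem C0Semigroup.conj_genGraph {Y : Type*} [NormedAddCommGroup Y] [NormedSpace ℝ Y]
    (S : C0Semigroup Y) (e : X ≃L[ℝ] Y) (x y : X) :
    (S.conj e).GenGraph x y ↔ S.GenGraph (e x) (e y) := by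
  have key : ∀ t : ℝ≥0, (t : ℝ)⁻¹ • ((S.conj e).T t x - x)
      = e.symm ((t : ℝ)⁻¹ • (S.T t (e x) - e x)) := by
    intro t
    simp [C0Semigroup.conj]
  unfold C0Semigroup.GenGraph
  simp only [key]
  constructor
  · intro h
    simpa [Function.comp_def] using (e.continuous.tendsto y).comp h
  · intro h
    simpa [Function.comp_def] using (e.symm.continuous.tendsto (e y)).comp h

/-- The Lumer–Phillips theorem on a Hilbert space, for a linear relation `G`. -/
theorem lumer_phillips_hilbert {H : Type*} [NormedAddCommGroup H] [InnerProductSpace ℝ H]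
    [CompleteSpace H] (G : Submodule ℝ (H × H))
    (hdiss : ∀ p ∈ G, inner ℝ p.2 p.1 ≤ 0)
    (hrange : ∀ l : ℝ, 0 < l → ∀ f, ∃ p ∈ G, l • p.1 - p.2 = f)
    (hsingle : ∀ y, ((0 : H), y) ∈ G → y = 0) :
    ∃ S : C0Semigroup H, (∀ t, ‖S.T t‖ ≤ 1) ∧ ∀ x y, S.GenGraph x y ↔ (x, y) ∈ G := by
  -- Dissipativity as a lower bound; it yields both injectivity of `l - 𝒜` and the resolvent
  -- estimate `‖R l‖ ≤ l⁻¹`.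
  have hbelow : ∀ l : ℝ, 0 < l → ∀ p ∈ G, l * ‖p.1‖ ≤ ‖l • p.1 - p.2‖ := by
    intro l hl p hp
    have h1 : l * ‖p.1‖ ^ 2 ≤ inner ℝ (l • p.1 - p.2) p.1 := by
      rw [inner_sub_left, real_inner_smul_left, real_inner_self_eq_norm_sq]
      linarith [hdiss p hp]
    have h2 := h1.trans (real_inner_le_norm _ _)
    rcases (norm_nonneg p.1).eq_or_lt with h0 | h0
    · rw [← h0]; simp
    · exact le_of_mul_le_mul_right (by linarith [h2, sq ‖p.1‖, mul_assoc l ‖p.1‖ ‖p.1‖]) h0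
  have huniq : ∀ l : ℝ, 0 < l → ∀ p ∈ G, ∀ q ∈ G, l • p.1 - p.2 = l • q.1 - q.2 → p.1 = q.1 := by
    intro l hl p hp q hq h
    have h1 := hbelow l hl _ (G.sub_mem hp hq)
    have h2 : l • (p - q).1 - (p - q).2 = 0 := by
      have : l • (p - q).1 - (p - q).2 = (l • p.1 - p.2) - (l • q.1 - q.2) := by
        simp only [Prod.fst_sub, Prod.snd_sub]; module
      rw [this, h, sub_self]
    rw [h2, norm_zero] at h1
    have h3 : ‖(p - q).1‖ ≤ 0 := nonpos_of_mul_nonpos_right h1 hl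
    exact sub_eq_zero.mp (norm_le_zero_iff.mp h3)
  -- Preimages are chosen arbitrarily; linearity of the resolvent `f ↦ (P l f).1` is then forced by
  -- uniqueness.
  choose! P hPG hPeq using hrange
  have hPadd : ∀ l, 0 < l → ∀ f g, (P l (f + g)).1 = (P l f).1 + (P l g).1 := by
    intro l hl f g
    refine huniq l hl _ (hPG l hl _) (P l f + P l g) (G.add_mem (hPG l hl _) (hPG l hl _)) ?_
    rw [hPeq l hl]
    nth_rewrite 1 [← hPeq l hl f, ← hPeq l hl g]
    simp only [Prod.fst_add, Prod.snd_add]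
    module
  have hPsmul : ∀ l, 0 < l → ∀ (r : ℝ) f, (P l (r • f)).1 = r • (P l f).1 := by
    intro l hl r f
    refine huniq l hl _ (hPG l hl _) (r • P l f) (G.smul_mem r (hPG l hl _)) ?_
    rw [hPeq l hl]
    nth_rewrite 1 [← hPeq l hl f]
    simp only [Prod.smul_fst, Prod.smul_snd]
    module
  have hPnorm : ∀ l, 0 < l → ∀ f, ‖(P l f).1‖ ≤ l⁻¹ * ‖f‖ := by
    intro l hl f
    have h1 := hbelow l hl _ (hPG l hl f)
    rw [hPeq l hl] at h1
    rw [← div_eq_inv_mul, le_div_iff₀ hl, mul_comm]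
    exact h1
  set R : ℝ → H →L[ℝ] H := fun l =>
    if hl : 0 < l then
      LinearMap.mkContinuous
        { toFun := fun f => (P l f).1
          map_add' := hPadd l hl
          map_smul' := hPsmul l hl } l⁻¹ (hPnorm l hl)
    else 0 with hR
  have hRP : ∀ l, 0 < l → ∀ f, R l f = (P l f).1 := by
    intro l hl f
    simp only [hR, dif_pos hl]
    rfl
  refine hille_yosida (fun x y => (x, y) ∈ G) R ?_ ?_ ?_
  · intro l hl
    refine ContinuousLinearMap.opNorm_le_bound _ (inv_pos.mpr hl).le fun f => ?_
    rw [hRP l hl]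
    exact hPnorm l hl f
  · intro l hl x y
    rw [hRP l hl]
    constructor
    · intro hxy
      exact huniq l hl _ (hPG l hl _) (x, y) hxy (hPeq l hl _)
    · intro h
      have h1 := hPeq l hl (l • x - y)
      rw [h] at h1
      have h2 : (P l (l • x - y)).2 = y := by
        rw [sub_right_inj] at h1
        exact h1
      have h3 := hPG l hl (l • x - y)
      have h4 : P l (l • x - y) = (x, y) := Prod.ext h h2
      rwa [h4] at h3
  · have hset : {x | ∃ y, (x, y) ∈ G} = (G.map (LinearMap.fst ℝ H H) : Set H) := by
      ext x
      simp
    rw [hset, Submodule.dense_iff_topologicalClosure_eq_top,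
      Submodule.topologicalClosure_eq_top_iff, Submodule.eq_bot_iff]
    -- If `z` is orthogonal to the domain and `p.1 - p.2 = z`, then `0 = ⟨z, p.1⟩ = ‖p.1‖² - ⟨p.2,
    -- p.1⟩ ≥ ‖p.1‖²`. So `p.1 = 0`, single-valuedness gives `p.2 = 0`, and `z = 0`.
    intro z hz
    have hp := hPG 1 one_pos z
    have he := hPeq 1 one_pos z
    set p := P 1 z
    have h1 : inner ℝ z p.1 = 0 := by
      have := hz p.1 (Submodule.mem_map_of_mem (f := LinearMap.fst ℝ H H) hp)
      rwa [real_inner_comm]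
    have h2 : p.1 = 0 := by
      rw [← he, one_smul, inner_sub_left, real_inner_self_eq_norm_sq] at h1
      have h3 := hdiss p hp
      have : ‖p.1‖ ^ 2 = 0 := le_antisymm (by linarith) (sq_nonneg _)
      exact norm_eq_zero.mp (pow_eq_zero_iff (two_ne_zero) |>.mp this)
    have h4 : p.2 = 0 := hsingle _ (by rw [← h2]; exact hp)
    rw [← he, h2, h4]
    simp

/-- The Lumer–Phillips theorem with respect to an equivalent inner product `b`. -/
theorem lumer_phillips [CompleteSpace X] {b : X → X → ℝ} (h : IsEquivalentInner b)
    (G : Submodule ℝ (X × X))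
    (hdiss : ∀ x y, (x, y) ∈ G → b y x ≤ 0)
    (hrange : ∀ l : ℝ, 0 < l → ∀ f, ∃ x y, (x, y) ∈ G ∧ l • x - y = f)
    (hsingle : ∀ y, ((0 : X), y) ∈ G → y = 0) :
    ∃ S : C0Semigroup X, (∀ t x, b (S.T t x) (S.T t x) ≤ b x x) ∧
      ∀ x y, S.GenGraph x y ↔ (x, y) ∈ G := by
  set e := Renormed.equiv h
  obtain ⟨S, hS, hgen⟩ := lumer_phillips_hilbert (H := Renormed h)
    (G.comap ((e.symm : Renormed h →ₗ[ℝ] X).prodMap (e.symm : Renormed h →ₗ[ℝ] X)))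
    (fun p hp => hdiss _ _ hp)
    (fun l hl f => by
      obtain ⟨x, y, hxy, hf⟩ := hrange l hl (e.symm f)
      exact ⟨(e x, e y), hxy, hf⟩)
    (fun y hy => hsingle _ hy)
  refine ⟨S.conj e, fun t x => ?_, fun x y => ?_⟩
  · have h1 : ‖S.T t (e x)‖ ≤ ‖e x‖ := by
      simpa using ContinuousLinearMap.le_of_opNorm_le _ (hS t) (e x)
    have h2 := pow_le_pow_left₀ (norm_nonneg _) h1 2
    rw [Renormed.norm_sq, Renormed.norm_sq] at h2
    exact h2
  · rw [C0Semigroup.conj_genGraph, hgen]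
    rfl

end Renorming

/-! ### The space `W₀^{1,2}`: weak derivatives, Poincaré and Korn. -/

section Sobolev

variable {Ω : Opens E3}

/-- The underlying function, as a continuous linear map. -/
def fnL (Ω : Opens E3) : W0 Ω →L[ℝ] L2 Ω :=
  (WithLp.fstL 2 ℝ (L2 Ω) (PiLp 2 (fun _ : Fin 3 => L2 Ω))).comp
    (testJets Ω).topologicalClosure.subtypeL

/-- The weak partial derivative, as a continuous linear map. -/
def dL (Ω : Opens E3) (j : Fin 3) : W0 Ω →L[ℝ] L2 Ω :=
  (PiLp.proj 2 (fun _ : Fin 3 => L2 Ω) j).comp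
    ((WithLp.sndL 2 ℝ (L2 Ω) (PiLp 2 (fun _ : Fin 3 => L2 Ω))).comp
      (testJets Ω).topologicalClosure.subtypeL)

theorem fnL_apply (w : W0 Ω) : fnL Ω w = w.fn := rfl

theorem dL_apply (w : W0 Ω) (j : Fin 3) : dL Ω j w = w.d j := rfl

theorem norm_sq_W0 (w : W0 Ω) : ‖w‖ ^ 2 = ‖w.fn‖ ^ 2 + ∑ j, ‖w.d j‖ ^ 2 := by
  change ‖w.1‖ ^ 2 = _
  rw [WithLp.prod_norm_sq_eq_of_L2, PiLp.norm_sq_eq_of_L2]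
  rfl

theorem W0_ext {w w' : W0 Ω} (h : w.fn = w'.fn) (hd : ∀ j, w.d j = w'.d j) : w = w' := by
  rw [← sub_eq_zero, ← norm_eq_zero, ← sq_eq_zero_iff, norm_sq_W0]
  have h1 : (w - w').fn = 0 := by
    rw [← fnL_apply, map_sub, fnL_apply, fnL_apply, h, sub_self]
  have h2 : ∀ j, (w - w').d j = 0 := fun j => by
    rw [← dL_apply, map_sub, dL_apply, dL_apply, hd, sub_self]
  simp [h1, h2]

theorem differentiable_test (φ : 𝓓(Ω, ℝ)) : Differentiable ℝ φ :=
  φ.contDiff.differentiable (by simp)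

theorem contDiff_pderiv_test (i : Fin 3) (φ : 𝓓(Ω, ℝ)) : ContDiff ℝ ((⊤ : ℕ∞) : WithTop ℕ∞) (pderiv i φ) := by
  have h : ContDiff ℝ ((⊤ : ℕ∞) : WithTop ℕ∞) (fderiv ℝ φ) := φ.contDiff.fderiv_right (by simp)
  exact h.clm_apply contDiff_const

theorem tsupport_pderiv_subset (i : Fin 3) (f : E3 → ℝ) : tsupport (pderiv i f) ⊆ tsupport f := by
  refine closure_minimal (fun x hx => ?_) (isClosed_tsupport f)
  refine support_fderiv_subset ℝ (f := f) ?_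
  intro h0
  exact hx (by simp [pderiv, h0])

/-- The partial derivative of a test function. -/
def pderivTest (i : Fin 3) (φ : 𝓓(Ω, ℝ)) : 𝓓(Ω, ℝ) where
  toFun := pderiv i φ
  contDiff' := contDiff_pderiv_test i φ
  hasCompactSupport' := φ.hasCompactSupport.of_isClosed_subset (isClosed_tsupport _)
    (tsupport_pderiv_subset i φ)
  tsupport_subset' := (tsupport_pderiv_subset i φ).trans φ.tsupport_subset

theorem coe_pderivTest (i : Fin 3) (φ : 𝓓(Ω, ℝ)) : (pderivTest i φ : E3 → ℝ) = pderiv i φ := rfl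

theorem memLp_test (φ : 𝓓(Ω, ℝ)) (p : ℝ≥0∞) (μ : Measure E3) [IsFiniteMeasureOnCompacts μ] :
    MemLp φ p μ :=
  φ.continuous.memLp_of_hasCompactSupport φ.hasCompactSupport

/-- A test function, as an element of `W₀^{1,2}(Ω)`. -/
def testJet (φ : 𝓓(Ω, ℝ)) : W0 Ω :=
  ⟨WithLp.toLp 2 ((memLp_test φ 2 (vol Ω)).toLp φ,
      WithLp.toLp 2 fun i => (memLp_test (pderivTest i φ) 2 (vol Ω)).toLp (pderivTest i φ)),
    subset_closure ⟨φ, MemLp.coeFn_toLp (memLp_test φ 2 (vol Ω)),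
      fun i => MemLp.coeFn_toLp (memLp_test (pderivTest i φ) 2 (vol Ω))⟩⟩

theorem coeFn_testJet_fn (φ : 𝓓(Ω, ℝ)) : ((testJet φ).fn : E3 → ℝ) =ᵐ[vol Ω] φ :=
  MemLp.coeFn_toLp (memLp_test φ 2 (vol Ω))

theorem coeFn_testJet_d (φ : 𝓓(Ω, ℝ)) (i : Fin 3) :
    ((testJet φ).d i : E3 → ℝ) =ᵐ[vol Ω] pderiv i φ :=
  MemLp.coeFn_toLp (memLp_test (pderivTest i φ) 2 (vol Ω))

/-- Closed conditions on `W₀^{1,2}` may therefore be checked on test functions alone. -/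
theorem denseRange_testJet : DenseRange (testJet : 𝓓(Ω, ℝ) → W0 Ω) := by
  have h1 : DenseRange (Set.inclusion (subset_closure (s := (testJets Ω : Set (Jet Ω))))) :=
    denseRange_inclusion_iff _ |>.mpr le_rfl
  refine h1.mono ?_
  rintro _ ⟨⟨w, φ, hw, hd⟩, rfl⟩
  refine ⟨φ, ?_⟩
  refine W0_ext ?_ fun j => ?_
  · exact Lp.ext ((coeFn_testJet_fn φ).trans hw.symm)
  · exact Lp.ext ((coeFn_testJet_d φ j).trans (hd j).symm)

theorem inner_L2_eq {f g : L2 Ω} {f' g' : E3 → ℝ} (hf : (f : E3 → ℝ) =ᵐ[vol Ω] f')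
    (hg : (g : E3 → ℝ) =ᵐ[vol Ω] g') : inner ℝ f g = ∫ x in (Ω : Set E3), f' x * g' x := by
  rw [L2.inner_def]
  refine integral_congr_ae ?_
  filter_upwards [hf, hg] with x h1 h2
  simp [h1, h2, mul_comm]

/-- The supports lie inside `Ω`, so both integrals extend to the whole space, where integration by
parts has no boundary term. -/
theorem setIntegral_mul_pderiv_test (φ ψ : 𝓓(Ω, ℝ)) (i : Fin 3) :
    ∫ x in (Ω : Set E3), φ x * pderiv i ψ x = -∫ x in (Ω : Set E3), pderiv i φ x * ψ x := by
  have hint : ∀ f g : 𝓓(Ω, ℝ), Integrable (fun x => f x * g x) (volume : Measure E3) := fun f g =>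
    (memLp_test f 2 volume).integrable_mul (memLp_test g 2 volume)
  have hzero : ∀ f g : 𝓓(Ω, ℝ), ∫ x in (Ω : Set E3), f x * g x = ∫ x, f x * g x := by
    intro f g
    refine setIntegral_eq_integral_of_forall_compl_eq_zero fun x hx => ?_
    rw [image_eq_zero_of_notMem_tsupport fun h => hx (f.tsupport_subset h), zero_mul]
  have h := integral_mul_fderiv_eq_neg_fderiv_mul_of_integrable (μ := (volume : Measure E3))
    (f := φ) (g := ψ) (v := EuclideanSpace.single i (1 : ℝ)) (hint (pderivTest i φ) ψ)
    (hint φ (pderivTest i ψ)) (hint φ ψ) (fun x _ => differentiable_test φ x)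
    (fun x _ => differentiable_test ψ x)
  have h1 := hzero φ (pderivTest i ψ)
  have h2 := hzero (pderivTest i φ) ψ
  simp only [coe_pderivTest] at h1 h2
  rw [h1, h2]
  exact h

theorem inner_fn_d (w w' : W0 Ω) (i : Fin 3) :
    inner ℝ w.fn (w'.d i) = -inner ℝ (w.d i) w'.fn := by
  refine denseRange_testJet.induction_on₂ (e := testJet)
    (p := fun w w' : W0 Ω => inner ℝ w.fn (w'.d i) = -inner ℝ (w.d i) w'.fn) ?_ ?_ w w'
  · have h1 : Continuous fun q : W0 Ω × W0 Ω => inner ℝ (fnL Ω q.1) (dL Ω i q.2) := by fun_prop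
    have h2 : Continuous fun q : W0 Ω × W0 Ω => -inner ℝ (dL Ω i q.1) (fnL Ω q.2) := by fun_prop
    exact isClosed_eq h1 h2
  · intro φ ψ
    rw [inner_L2_eq (coeFn_testJet_fn φ) (coeFn_testJet_d ψ i),
      inner_L2_eq (coeFn_testJet_d φ i) (coeFn_testJet_fn ψ), setIntegral_mul_pderiv_test]

theorem pderiv_pderiv_comm (φ : 𝓓(Ω, ℝ)) (i j : Fin 3) :
    pderiv j (pderiv i φ) = pderiv i (pderiv j φ) := by
  have hd : Differentiable ℝ (fderiv ℝ (φ : E3 → ℝ)) :=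
    ContDiff.differentiable (n := ((⊤ : ℕ∞) : WithTop ℕ∞)) (φ.contDiff.fderiv_right (by simp)) (by simp)
  have key : ∀ (a b : Fin 3) x, pderiv b (pderiv a φ) x
      = fderiv ℝ (fderiv ℝ φ) x (EuclideanSpace.single b 1) (EuclideanSpace.single a 1) := by
    intro a b x
    change fderiv ℝ (fun y => fderiv ℝ φ y (EuclideanSpace.single a 1)) x _ = _
    rw [fderiv_clm_apply (hd x) (differentiableAt_const _)]
    simp
  ext x
  rw [key, key]
  exact second_derivative_symmetric (fun y => (differentiable_test φ y).hasFDerivAt)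
    (hd x).hasFDerivAt _ _

/-- The identity behind Korn's inequality. For a test function `φ` in the first slot, moving the
second derivative off `w'` turns either side into `-⟨∂ᵢ∂ⱼφ, w'⟩`; approximating one argument is
enough. -/
theorem inner_d_d (w w' : W0 Ω) (i j : Fin 3) :
    inner ℝ (w.d i) (w'.d j) = inner ℝ (w.d j) (w'.d i) := by
  refine denseRange_testJet.induction_on (p := fun w : W0 Ω => inner ℝ (w.d i) (w'.d j)
    = inner ℝ (w.d j) (w'.d i)) w ?_ ?_
  · have h1 : Continuous fun q : W0 Ω => inner ℝ (dL Ω i q) (w'.d j) := by fun_prop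
    have h2 : Continuous fun q : W0 Ω => inner ℝ (dL Ω j q) (w'.d i) := by fun_prop
    exact isClosed_eq h1 h2
  · intro φ
    have key : ∀ a, (testJet φ).d a = (testJet (pderivTest a φ)).fn := fun a => rfl
    have h2 : (testJet (pderivTest i φ)).d j = (testJet (pderivTest j φ)).d i := by
      refine Lp.ext ?_
      filter_upwards [coeFn_testJet_d (pderivTest i φ) j, coeFn_testJet_d (pderivTest j φ) i]
        with x h1 h2
      rw [h1, h2, coe_pderivTest, coe_pderivTest, pderiv_pderiv_comm]
    rw [key i, key j, inner_fn_d, inner_fn_d, h2]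

/-- A function on `Ω` that is orthogonal to all test functions vanishes. -/
theorem ae_eq_zero_of_forall_test {f : E3 → ℝ} (hf : MemLp f 2 (vol Ω))
    (h : ∀ φ : 𝓓(Ω, ℝ), ∫ x in (Ω : Set E3), f x * φ x = 0) : f =ᵐ[vol Ω] 0 := by
  have hloc : LocallyIntegrableOn f (Ω : Set E3) volume := by
    refine (locallyIntegrableOn_iff Ω.isOpen.isLocallyClosed).mpr fun K hK hKc => ?_
    have h1 : MemLp f 2 (volume.restrict K) := hf.mono_measure (Measure.restrict_mono hK le_rfl)
    have : IsFiniteMeasure ((volume : Measure E3).restrict K) :=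
      ⟨by rw [Measure.restrict_apply_univ]; exact hKc.measure_lt_top⟩
    exact h1.integrable one_le_two
  have := Ω.isOpen.ae_eq_zero_of_integral_contDiff_smul_eq_zero hloc (fun g hg hgc hgs => by
    have h1 := h ⟨g, hg, hgc, hgs⟩
    rw [setIntegral_eq_integral_of_forall_compl_eq_zero] at h1
    · simpa [mul_comm] using h1
    · intro x hx
      have : g x = 0 := image_eq_zero_of_notMem_tsupport fun h => hx (hgs h)
      change f x * g x = 0
      rw [this, mul_zero])
  exact (ae_restrict_iff' Ω.isOpen.measurableSet).mpr this

theorem L2_eq_zero_of_inner_test {f : L2 Ω} (h : ∀ φ : 𝓓(Ω, ℝ), inner ℝ f (testJet φ).fn = 0) :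
    f = 0 := by
  refine (Lp.eq_zero_iff_ae_eq_zero).mpr (ae_eq_zero_of_forall_test (Lp.memLp f) fun φ => ?_)
  rw [← h φ, inner_L2_eq EventuallyEq.rfl (coeFn_testJet_fn φ)]

/-- An element of `W₀^{1,2}(Ω)` is determined by its underlying function. -/
theorem eq_zero_of_fn_eq_zero {w : W0 Ω} (h : w.fn = 0) : w = 0 := by
  -- The weak derivative is determined by the function: `⟨w_{,j}, φ⟩ = -⟨w, φ_{,j}⟩ = 0` for every
  -- test function.
  have hd : ∀ j, w.d j = 0 := fun j => L2_eq_zero_of_inner_test fun φ => by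
    rw [← neg_eq_zero, ← inner_fn_d, h, inner_zero_left]
  rw [← norm_eq_zero, ← sq_eq_zero_iff, norm_sq_W0]
  simp [h, hd]

/-- The Poincaré inequality on a bounded open set. -/
theorem exists_poincare (hΩ : Bornology.IsBounded (Ω : Set E3)) :
    ∃ C : ℝ, 0 ≤ C ∧ ∀ w : W0 Ω, ‖w.fn‖ ≤ C * ∑ j, ‖w.d j‖ := by
  -- The Gagliardo–Nirenberg–Sobolev constant of the bounded set `Ω` with both exponents `2`,
  -- admissible since `2 < 3`.
  set C : ℝ≥0 := eLpNormLESNormFDerivOfLeConst ℝ (volume : Measure E3) (Ω : Set E3) 2 2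
  refine ⟨C, C.2, fun w => ?_⟩
  refine denseRange_testJet.induction_on
    (p := fun w : W0 Ω => ‖w.fn‖ ≤ C * ∑ j, ‖w.d j‖) w ?_ ?_
  · have h1 : Continuous fun q : W0 Ω => ‖fnL Ω q‖ := by fun_prop
    have h2 : Continuous fun q : W0 Ω => (C : ℝ) * ∑ j, ‖dL Ω j q‖ := by fun_prop
    exact isClosed_le h1 h2
  · intro φ
    have hsupp : ∀ ψ : 𝓓(Ω, ℝ), Function.support ψ ⊆ (Ω : Set E3) := fun ψ =>
      (subset_tsupport _).trans ψ.tsupport_subset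
    have hnorm : ∀ ψ : 𝓓(Ω, ℝ), ‖(testJet ψ).fn‖ = (eLpNorm ψ 2 volume).toReal := by
      intro ψ
      rw [Lp.norm_def, eLpNorm_congr_ae (coeFn_testJet_fn ψ),
        eLpNorm_restrict_eq_of_support_subset (hsupp ψ)]
    have hbd : ∀ x, ‖fderiv ℝ φ x‖ ≤ ∑ j, ‖pderiv j φ x‖ := by
      intro x
      refine ContinuousLinearMap.opNorm_le_bound _ (Finset.sum_nonneg fun _ _ => norm_nonneg _) ?_
      intro y
      have hy : y = ∑ j, y j • EuclideanSpace.single j (1 : ℝ) := by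
        have := (EuclideanSpace.basisFun (Fin 3) ℝ).sum_repr y
        simpa using this.symm
      nth_rewrite 1 [hy]
      rw [map_sum, Finset.sum_mul]
      refine (norm_sum_le _ _).trans (Finset.sum_le_sum fun j _ => ?_)
      rw [map_smul, norm_smul, mul_comm]
      exact mul_le_mul_of_nonneg_left (PiLp.norm_apply_le y j) (norm_nonneg _)
    have h1 : eLpNorm φ 2 volume ≤ C * eLpNorm (fderiv ℝ φ) 2 volume := by
      have := eLpNorm_le_eLpNorm_fderiv (volume : Measure E3) (u := φ) (s := (Ω : Set E3)) (p := 2)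
        (φ.contDiff.of_le (by simp)) (hsupp φ) (by norm_num) (by simp; norm_num) hΩ
      simpa using this
    have h2 : eLpNorm (fderiv ℝ φ) 2 volume ≤ ∑ j, eLpNorm (pderiv j φ) 2 volume := by
      calc eLpNorm (fderiv ℝ φ) 2 volume
          ≤ eLpNorm (∑ j, fun x => ‖pderiv j φ x‖) 2 volume :=
            eLpNorm_mono_real fun x => by simpa using hbd x
        _ ≤ ∑ j, eLpNorm (fun x => ‖pderiv j φ x‖) 2 volume :=
            eLpNorm_sum_le (fun j _ =>
              (pderivTest j φ).continuous.norm.aestronglyMeasurable) one_le_two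
        _ = ∑ j, eLpNorm (pderiv j φ) 2 volume := by simp only [eLpNorm_norm]
    have hfin : ∀ j, eLpNorm (pderiv j φ) 2 volume ≠ ⊤ := fun j =>
      (memLp_test (pderivTest j φ) 2 volume).eLpNorm_ne_top
    have h3 := h1.trans (mul_le_mul_right h2 (C : ℝ≥0∞))
    have h4 : ∀ j, ‖(testJet φ).d j‖ = (eLpNorm (pderiv j φ) 2 volume).toReal := fun j =>
      hnorm (pderivTest j φ)
    simp only [h4]
    rw [hnorm, ← ENNReal.toReal_sum fun j _ => hfin j]
    have h5 := ENNReal.toReal_mono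
      (ENNReal.mul_ne_top ENNReal.coe_ne_top (ENNReal.sum_ne_top.mpr fun j _ => hfin j)) h3
    simpa using h5

/-- Korn's inequality. -/
theorem korn (u : Fin 3 → W0 Ω) :
    (1 / 2) * ∑ i, ∑ j, ‖(u i).d j‖ ^ 2
      ≤ ∑ i, ∑ j, ‖(1 / 2 : ℝ) • ((u i).d j + (u j).d i)‖ ^ 2 := by
  -- The cross term `⟨u_{i,j}, u_{j,i}⟩` equals `⟨u_{i,i}, u_{j,j}⟩` by `inner_d_d`. Its double sum
  -- is `‖div u‖² ≥ 0` and can be dropped.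
  have h1 : ∀ i j, ‖(1 / 2 : ℝ) • ((u i).d j + (u j).d i)‖ ^ 2
      = (1 / 4) * ‖(u i).d j‖ ^ 2 + (1 / 4) * ‖(u j).d i‖ ^ 2
        + (1 / 2) * inner ℝ ((u i).d i) ((u j).d j) := by
    intro i j
    rw [norm_smul, mul_pow, norm_add_sq_real, inner_d_d (u i) (u j) j i]
    norm_num
    ring
  have h2 : ∑ i, ∑ j, inner ℝ ((u i).d i) ((u j).d j) = ‖∑ i, (u i).d i‖ ^ 2 := by
    rw [← real_inner_self_eq_norm_sq, sum_inner]
    simp only [inner_sum]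
  have h3 : ∑ i, ∑ j, ‖(u j).d i‖ ^ 2 = ∑ i, ∑ j, ‖(u i).d j‖ ^ 2 := Finset.sum_comm
  simp only [h1, Finset.sum_add_distrib, ← Finset.mul_sum, h2, h3]
  nlinarith [sq_nonneg ‖∑ i, (u i).d i‖]

end Sobolev

/-! ### Calculus of integrands that depend boundedly and (bi)linearly on parameters. -/

section Integrands

variable {α : Type*} [MeasurableSpace α] {μ : Measure α}
  {X Y X' Y' : Type*} [NormedAddCommGroup X] [NormedSpace ℝ X] [NormedAddCommGroup Y]
  [NormedSpace ℝ Y] [NormedAddCommGroup X'] [NormedSpace ℝ X'] [NormedAddCommGroup Y']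
  [NormedSpace ℝ Y']

/-- The functions `f x` represent a bounded linear map from `X` to `L²(μ)`. -/
def IsL2Linear (μ : Measure α) (f : X → α → ℝ) : Prop :=
  ∃ ℓ : X →L[ℝ] Lp ℝ 2 μ, ∀ x, f x =ᵐ[μ] ℓ x

/-- The functions `F x y` represent a bounded bilinear map from `X × Y` to `L¹(μ)`. -/
def IsL1Bilinear (μ : Measure α) (F : X → Y → α → ℝ) : Prop :=
  ∃ Φ : X →L[ℝ] Y →L[ℝ] Lp ℝ 1 μ, ∀ x y, F x y =ᵐ[μ] Φ x y

namespace IsL2Linear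

theorem of_bounded {T : X → Lp ℝ 2 μ} (hT : IsBoundedLinearMap ℝ T) :
    IsL2Linear μ (fun x => (T x : α → ℝ)) :=
  ⟨hT.toContinuousLinearMap, fun _ => EventuallyEq.rfl⟩

theorem comp {f : X → α → ℝ} (hf : IsL2Linear μ f) {p : X' → X} (hp : IsBoundedLinearMap ℝ p) :
    IsL2Linear μ (fun x => f (p x)) := by
  obtain ⟨ℓ, hℓ⟩ := hf
  exact ⟨ℓ.comp hp.toContinuousLinearMap, fun x => hℓ (p x)⟩

theorem memLp {f : X → α → ℝ} (hf : IsL2Linear μ f) (x : X) : MemLp (f x) 2 μ := by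
  obtain ⟨ℓ, hℓ⟩ := hf
  exact (memLp_congr_ae (hℓ x)).mpr (Lp.memLp _)

theorem add {f g : X → α → ℝ} (hf : IsL2Linear μ f) (hg : IsL2Linear μ g) :
    IsL2Linear μ (fun x a => f x a + g x a) := by
  obtain ⟨ℓ, hℓ⟩ := hf
  obtain ⟨k, hk⟩ := hg
  refine ⟨ℓ + k, fun x => ?_⟩
  filter_upwards [hℓ x, hk x, Lp.coeFn_add (ℓ x) (k x)] with a h1 h2 h3
  rw [h1, h2]
  exact h3.symm

theorem Linfty_mul {m : α → ℝ} (hm : MemLp m ∞ μ) {f : X → α → ℝ} (hf : IsL2Linear μ f) :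
    IsL2Linear μ (fun x a => m a * f x a) := by
  obtain ⟨ℓ, hℓ⟩ := hf
  refine ⟨((ContinuousLinearMap.mul ℝ ℝ).holderL μ ∞ 2 2 (hm.toLp m)).comp ℓ, fun x => ?_⟩
  filter_upwards [hℓ x, hm.coeFn_toLp,
    (ContinuousLinearMap.mul ℝ ℝ).coeFn_holder (r := 2) (hm.toLp m) (ℓ x)] with a h1 h2 h3
  rw [h1]
  refine Eq.trans ?_ h3.symm
  rw [h2]
  rfl

theorem neg {f : X → α → ℝ} (hf : IsL2Linear μ f) : IsL2Linear μ (fun x a => -f x a) := by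
  obtain ⟨ℓ, hℓ⟩ := hf
  refine ⟨-ℓ, fun x => ?_⟩
  filter_upwards [hℓ x, Lp.coeFn_neg (ℓ x)] with a h1 h3
  rw [h1]
  exact h3.symm

theorem sub {f g : X → α → ℝ} (hf : IsL2Linear μ f) (hg : IsL2Linear μ g) :
    IsL2Linear μ (fun x a => f x a - g x a) := by
  simpa only [sub_eq_add_neg] using hf.add hg.neg

theorem const_mul (r : ℝ) {f : X → α → ℝ} (hf : IsL2Linear μ f) :
    IsL2Linear μ (fun x a => r * f x a) :=
  hf.Linfty_mul (memLp_top_const r)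

theorem zero : IsL2Linear μ (fun (_ : X) (_ : α) => (0 : ℝ)) :=
  ⟨0, fun _ => (Lp.coeFn_zero ℝ 2 μ).symm⟩

theorem sum {ι : Type*} (s : Finset ι) {f : ι → X → α → ℝ} (hf : ∀ i, IsL2Linear μ (f i)) :
    IsL2Linear μ (fun x a => ∑ i ∈ s, f i x a) := by
  classical
  induction s using Finset.induction_on with
  | empty => simpa using zero
  | insert i s hi ih =>
    simp only [Finset.sum_insert hi]
    exact (hf i).add ih

end IsL2Linear

namespace IsL1Bilinear

theorem integrable {F : X → Y → α → ℝ} (hF : IsL1Bilinear μ F) (x : X) (y : Y) :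
    Integrable (F x y) μ := by
  obtain ⟨Φ, hΦ⟩ := hF
  exact (integrable_congr (hΦ x y)).mpr (L1.integrable_coeFn _)

theorem exists_form {F : X → Y → α → ℝ} (hF : IsL1Bilinear μ F) :
    ∃ b : X →L[ℝ] Y →L[ℝ] ℝ, ∀ x y, b x y = ∫ a, F x y a ∂μ := by
  obtain ⟨Φ, hΦ⟩ := hF
  refine ⟨(ContinuousLinearMap.compL ℝ Y (Lp ℝ 1 μ) ℝ L1.integralCLM).comp Φ, fun x y => ?_⟩
  rw [integral_congr_ae (hΦ x y), ← L1.integral_eq_integral, L1.integral_eq]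
  rfl

/-- The bilinear form obtained by integration. -/
def form {F : X → Y → α → ℝ} (hF : IsL1Bilinear μ F) : X →L[ℝ] Y →L[ℝ] ℝ :=
  hF.exists_form.choose

theorem form_apply {F : X → Y → α → ℝ} (hF : IsL1Bilinear μ F) (x : X) (y : Y) :
    hF.form x y = ∫ a, F x y a ∂μ :=
  hF.exists_form.choose_spec x y

theorem add {F G : X → Y → α → ℝ} (hF : IsL1Bilinear μ F) (hG : IsL1Bilinear μ G) :
    IsL1Bilinear μ (fun x y a => F x y a + G x y a) := by
  obtain ⟨Φ, hΦ⟩ := hF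
  obtain ⟨Ψ, hΨ⟩ := hG
  refine ⟨Φ + Ψ, fun x y => ?_⟩
  filter_upwards [hΦ x y, hΨ x y, Lp.coeFn_add (Φ x y) (Ψ x y)] with a h1 h2 h3
  rw [h1, h2]
  exact h3.symm

theorem neg {F : X → Y → α → ℝ} (hF : IsL1Bilinear μ F) :
    IsL1Bilinear μ (fun x y a => -F x y a) := by
  obtain ⟨Φ, hΦ⟩ := hF
  refine ⟨-Φ, fun x y => ?_⟩
  filter_upwards [hΦ x y, Lp.coeFn_neg (Φ x y)] with a h1 h3
  rw [h1]
  exact h3.symm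

theorem sub {F G : X → Y → α → ℝ} (hF : IsL1Bilinear μ F) (hG : IsL1Bilinear μ G) :
    IsL1Bilinear μ (fun x y a => F x y a - G x y a) := by
  simpa only [sub_eq_add_neg] using hF.add hG.neg

theorem zero : IsL1Bilinear μ (fun (_ : X) (_ : Y) (_ : α) => (0 : ℝ)) :=
  ⟨0, fun _ _ => (Lp.coeFn_zero ℝ 1 μ).symm⟩

theorem sum {ι : Type*} (s : Finset ι) {F : ι → X → Y → α → ℝ}
    (hF : ∀ i, IsL1Bilinear μ (F i)) : IsL1Bilinear μ (fun x y a => ∑ i ∈ s, F i x y a) := by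
  classical
  induction s using Finset.induction_on with
  | empty => simpa using zero
  | insert i s hi ih =>
    simp only [Finset.sum_insert hi]
    exact (hF i).add ih

theorem mul {f : X → α → ℝ} {g : Y → α → ℝ} (hf : IsL2Linear μ f) (hg : IsL2Linear μ g) :
    IsL1Bilinear μ (fun x y a => f x a * g y a) := by
  obtain ⟨ℓ, hℓ⟩ := hf
  obtain ⟨k, hk⟩ := hg
  refine ⟨((ContinuousLinearMap.mul ℝ ℝ).holderL μ 2 2 1).bilinearComp ℓ k, fun x y => ?_⟩
  filter_upwards [hℓ x, hk y,
    (ContinuousLinearMap.mul ℝ ℝ).coeFn_holder (r := 1) (ℓ x) (k y)] with a h1 h2 h3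
  rw [h1, h2]
  exact h3.symm

/-- Needed for terms such as `e'_{ij} R_{k,l}`, in which the second argument supplies the left
factor. -/
theorem mul_swap {f : Y → α → ℝ} {g : X → α → ℝ} (hf : IsL2Linear μ f) (hg : IsL2Linear μ g) :
    IsL1Bilinear μ (fun x y a => f y a * g x a) := by
  simpa only [mul_comm] using mul hg hf

theorem Linfty_mul {m : α → ℝ} (hm : MemLp m ∞ μ) {F : X → Y → α → ℝ} (hF : IsL1Bilinear μ F) :
    IsL1Bilinear μ (fun x y a => m a * F x y a) := by
  obtain ⟨Φ, hΦ⟩ := hF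
  refine ⟨(ContinuousLinearMap.compL ℝ Y (Lp ℝ 1 μ) (Lp ℝ 1 μ)
    ((ContinuousLinearMap.mul ℝ ℝ).holderL μ ∞ 1 1 (hm.toLp m))).comp Φ, fun x y => ?_⟩
  filter_upwards [hΦ x y, hm.coeFn_toLp,
    (ContinuousLinearMap.mul ℝ ℝ).coeFn_holder (r := 1) (hm.toLp m) (Φ x y)] with a h1 h2 h3
  rw [h1]
  refine Eq.trans ?_ h3.symm
  rw [h2]
  rfl

theorem comp {F : X → Y → α → ℝ} (hF : IsL1Bilinear μ F) {p : X' → X} {q : Y' → Y}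
    (hp : IsBoundedLinearMap ℝ p) (hq : IsBoundedLinearMap ℝ q) :
    IsL1Bilinear μ (fun x y => F (p x) (q y)) := by
  obtain ⟨Φ, hΦ⟩ := hF
  exact ⟨Φ.bilinearComp hp.toContinuousLinearMap hq.toContinuousLinearMap,
    fun x y => hΦ (p x) (q y)⟩

theorem integral_add_left {F : X → Y → α → ℝ} (hF : IsL1Bilinear μ F) (x x' : X) (y : Y) :
    ∫ a, F (x + x') y a ∂μ = (∫ a, F x y a ∂μ) + ∫ a, F x' y a ∂μ := by
  simp only [← hF.form_apply, map_add, add_apply]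

theorem integral_smul_left {F : X → Y → α → ℝ} (hF : IsL1Bilinear μ F) (r : ℝ) (x : X) (y : Y) :
    ∫ a, F (r • x) y a ∂μ = r * ∫ a, F x y a ∂μ := by
  simp only [← hF.form_apply, map_smul, smul_apply, smul_eq_mul]

theorem integral_zero_right {F : X → Y → α → ℝ} (hF : IsL1Bilinear μ F) (x : X) :
    ∫ a, F x 0 a ∂μ = 0 := by
  rw [← hF.form_apply, map_zero]

theorem integral_le {F : X → X → α → ℝ} (hF : IsL1Bilinear μ F) :
    ∃ M : ℝ, 0 < M ∧ ∀ x, ∫ a, F x x a ∂μ ≤ M * ‖x‖ ^ 2 := by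
  refine ⟨‖hF.form‖ + 1, by positivity, fun x => ?_⟩
  rw [← hF.form_apply]
  have h1 := (le_abs_self _).trans (hF.form.le_opNorm₂ x x)
  nlinarith [sq_nonneg ‖x‖]

/-- The Lax–Milgram theorem for integral forms. -/
theorem exists_forall_integral_eq [CompleteSpace X] {b : X → X → ℝ} (h : IsEquivalentInner b)
    {F : X → X → α → ℝ} (hF : IsL1Bilinear μ F) {m : ℝ} (hm : 0 < m)
    (hco : ∀ x, m * ‖x‖ ^ 2 ≤ ∫ a, F x x a ∂μ) {G : Y → X → α → ℝ} (hG : IsL1Bilinear μ G)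
    (y : Y) : ∃ x, ∀ z, ∫ a, F x z a ∂μ = ∫ a, G y z a ∂μ := by
  obtain ⟨x, hx⟩ := exists_forall_bilin_eq h hF.form hm
    (fun x => by rw [hF.form_apply]; exact hco x) (hG.form y)
  exact ⟨x, fun z => by rw [← hF.form_apply, ← hG.form_apply, hx]⟩

theorem integral_eq_zero_of_denseRange {ι : Type*} {e : ι → Y} (he : DenseRange e)
    {F : X → Y → α → ℝ} (hF : IsL1Bilinear μ F) {x : X} (h : ∀ i, ∫ a, F x (e i) a ∂μ = 0)
    (y : Y) : ∫ a, F x y a ∂μ = 0 := by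
  rw [← hF.form_apply]
  refine he.induction_on (p := fun y => hF.form x y = 0) y
    (isClosed_eq (hF.form x).continuous continuous_const) fun i => ?_
  rw [hF.form_apply, h]

end IsL1Bilinear

end Integrands

/-! ### Tensor contractions and the pointwise power balance. -/

section TensorSums

variable {ι : Type*} [Fintype ι]

theorem sum4_swap_first (f : ι → ι → ι → ι → ℝ) :
    ∑ i, ∑ j, ∑ k, ∑ l, f i j k l = ∑ i, ∑ j, ∑ k, ∑ l, f j i k l :=
  Finset.sum_comm

theorem sum4_swap_last (f : ι → ι → ι → ι → ℝ) :
    ∑ i, ∑ j, ∑ k, ∑ l, f i j k l = ∑ i, ∑ j, ∑ k, ∑ l, f i j l k :=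
  Finset.sum_congr rfl fun _ _ => Finset.sum_congr rfl fun _ _ => Finset.sum_comm

theorem sum4_swap_pairs (f : ι → ι → ι → ι → ℝ) :
    ∑ i, ∑ j, ∑ k, ∑ l, f i j k l = ∑ i, ∑ j, ∑ k, ∑ l, f k l i j := by
  have h := Finset.sum_comm (s := (Finset.univ : Finset (ι × ι)))
    (t := (Finset.univ : Finset (ι × ι))) (f := fun p q => f p.1 p.2 q.1 q.2)
  simpa only [Fintype.sum_prod_type] using h

variable {T : ι → ι → ι → ι → ℝ}

/-- Contraction of a tensor having the minor symmetries with a symmetrized matrix. -/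
theorem sum4_strain_first (h1 : ∀ i j k l, T i j k l = T j i k l) {X E : ι → ι → ℝ}
    (hE : ∀ i j, E i j = (1 / 2) * (X i j + X j i)) (Y : ι → ι → ℝ) :
    ∑ i, ∑ j, ∑ k, ∑ l, T i j k l * (E i j * Y k l)
      = ∑ i, ∑ j, ∑ k, ∑ l, T i j k l * (X i j * Y k l) := by
  have h3 : ∑ i, ∑ j, ∑ k, ∑ l, T i j k l * (X j i * Y k l)
      = ∑ i, ∑ j, ∑ k, ∑ l, T i j k l * (X i j * Y k l) := by
    rw [sum4_swap_first]
    simp only [fun i j k l => (h1 i j k l).symm]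
  calc _ = ∑ i, ∑ j, ∑ k, ∑ l, ((1 / 2) * (T i j k l * (X i j * Y k l))
        + (1 / 2) * (T i j k l * (X j i * Y k l))) := by
        refine Finset.sum_congr rfl fun i _ => Finset.sum_congr rfl fun j _ =>
          Finset.sum_congr rfl fun k _ => Finset.sum_congr rfl fun l _ => ?_
        rw [hE]; ring
    _ = _ := by
        simp only [Finset.sum_add_distrib, ← Finset.mul_sum]
        rw [h3]; ring

theorem sum4_pairs_comm (h2 : ∀ i j k l, T i j k l = T k l i j) (X Y : ι → ι → ℝ) :
    ∑ i, ∑ j, ∑ k, ∑ l, T i j k l * (X i j * Y k l)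
      = ∑ i, ∑ j, ∑ k, ∑ l, T i j k l * (Y i j * X k l) := by
  rw [sum4_swap_pairs]
  refine Finset.sum_congr rfl fun i _ => Finset.sum_congr rfl fun j _ =>
    Finset.sum_congr rfl fun k _ => Finset.sum_congr rfl fun l _ => ?_
  rw [← h2]; ring

/-- Brings a flux paired with a gradient to the normal form `T i j k l * (Y i j * X k l)`, in which
the work terms and the stored-energy terms can be compared. -/
theorem sum4_flux (h1 : ∀ i j k l, T i j k l = T j i k l) (X Y : ι → ι → ℝ) :
    ∑ i, ∑ j, (∑ k, ∑ l, T j i k l * X k l) * Y i j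
      = ∑ i, ∑ j, ∑ k, ∑ l, T i j k l * (Y i j * X k l) := by
  refine Finset.sum_congr rfl fun i _ => Finset.sum_congr rfl fun j _ => ?_
  simp only [Finset.sum_mul]
  refine Finset.sum_congr rfl fun k _ => Finset.sum_congr rfl fun l _ => ?_
  rw [h1 i j]; ring

end TensorSums

/-- The pointwise power balance: the three residual densities of the equations, tested with the
velocities, add up to the density of the energy product plus the dissipation density. -/
theorem power_balance {ρ c : ℝ} {a b d cT K Kt : Fin 3 → Fin 3 → ℝ}
    {A B C Ct : Fin 3 → Fin 3 → Fin 3 → Fin 3 → ℝ}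
    (ha : ∀ i j, a i j = a j i) (hd : ∀ i j, d i j = d j i) (hcT : ∀ i j, cT i j = cT j i)
    (hA₁ : ∀ i j k l, A i j k l = A j i k l) (hA₂ : ∀ i j k l, A i j k l = A k l i j)
    (hB₁ : ∀ i j k l, B i j k l = B j i k l) (hB₂ : ∀ i j k l, B i j k l = B k l i j)
    (hC₁ : ∀ i j k l, C i j k l = C j i k l)
    (v v' m m' : Fin 3 → ℝ) (θ θ' : ℝ) {du dR dv dm eu ev : Fin 3 → Fin 3 → ℝ}
    (dτ dθ : Fin 3 → ℝ)
    (heu : ∀ i j, eu i j = (1 / 2) * (du i j + du j i))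
    (hev : ∀ i j, ev i j = (1 / 2) * (dv i j + dv j i)) :
    (∑ i, (ρ * v' i * v i - -∑ j, ((∑ k, ∑ l, A j i k l * du k l) - a j i * θ
        + ∑ k, ∑ l, B j i k l * dR l k) * dv i j))
      + (c * θ' * θ - (-(∑ i, ∑ j, a i j * dv i j) * θ
          - (∑ i, ∑ j, (K i j * dτ j + Kt i j * dθ j - d i j * m j) * dθ i)
          - (∑ i, ∑ j, b j i * dm i j) * θ))
      + ∑ i, ((∑ j, cT i j * m' j) * m i
          - (-(∑ j, ((∑ k, ∑ l, B k l j i * du k l) - b j i * θ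
              + (∑ k, ∑ l, C j i k l * dR k l) + ∑ k, ∑ l, Ct j i k l * dm k l) * dm i j)
            - (∑ j, d i j * dθ j) * m i))
    = ((∑ i, ρ * v' i * v i) + c * θ' * θ + (∑ i, ∑ j, cT i j * m' i * m j)
        + ((∑ i, ∑ j, ∑ k, ∑ l, (A i j k l * ev k l * eu i j
            + B i j k l * (ev i j * dR k l + eu i j * dm k l) + C i j k l * dm i j * dR k l))
          + ∑ i, ∑ j, K i j * dθ i * dτ j))
      + ((∑ i, ∑ j, Kt i j * dθ i * dθ j)
        + ∑ i, ∑ j, ∑ k, ∑ l, Ct i j k l * dm k l * dm j i) := by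
  -- Minor symmetry removes each symmetrization in turn, with the major symmetry exchanging the two
  -- pairs in between.
  have tA : ∑ i, ∑ j, (∑ k, ∑ l, A j i k l * du k l) * dv i j
      = ∑ i, ∑ j, ∑ k, ∑ l, A i j k l * ev k l * eu i j := by
    have e : ∀ i j k l, A i j k l * ev k l * eu i j = A i j k l * (eu i j * ev k l) :=
      fun i j k l => by ring
    simp only [e]
    rw [sum4_strain_first hA₁ heu, sum4_pairs_comm hA₂, sum4_strain_first hA₁ hev, sum4_flux hA₁]
  have tB₁ : ∑ i, ∑ j, (∑ k, ∑ l, B j i k l * dR l k) * dv i j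
      = ∑ i, ∑ j, ∑ k, ∑ l, B i j k l * (ev i j * dR k l) := by
    rw [sum4_strain_first hB₁ hev, sum4_flux hB₁ (fun k l => dR l k), sum4_swap_last]
    -- Symmetry in the last pair is not assumed; it follows from symmetry in the first pair
    -- conjugated by the exchange of pairs.
    have e : ∀ i j k l, B i j l k = B i j k l := fun i j k l => by
      rw [hB₂ i j l k, hB₁ l k, hB₂ k l]
    simp only [e]
  have tB₂ : ∑ i, ∑ j, (∑ k, ∑ l, B k l j i * du k l) * dm i j
      = ∑ i, ∑ j, ∑ k, ∑ l, B i j k l * (eu i j * dm k l) := by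
    rw [sum4_strain_first hB₁ heu, sum4_pairs_comm hB₂, ← sum4_flux hB₁]
    simp only [fun i j k l => hB₂ k l j i]
  have tC : ∑ i, ∑ j, (∑ k, ∑ l, C j i k l * dR k l) * dm i j
      = ∑ i, ∑ j, ∑ k, ∑ l, C i j k l * dm i j * dR k l := by
    rw [sum4_flux hC₁]
    simp only [mul_assoc]
  have tCt : ∑ i, ∑ j, (∑ k, ∑ l, Ct j i k l * dm k l) * dm i j
      = ∑ i, ∑ j, ∑ k, ∑ l, Ct i j k l * dm k l * dm j i := by
    rw [Finset.sum_comm]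
    simp only [Finset.sum_mul]
  -- The identities `ta`, `tb`, `td` match coupling terms that enter two different balance laws with
  -- opposite signs, so they cancel in the sum.
  have ta : ∑ i, ∑ j, a j i * θ * dv i j = (∑ i, ∑ j, a i j * dv i j) * θ := by
    simp only [Finset.sum_mul]
    refine Finset.sum_congr rfl fun i _ => Finset.sum_congr rfl fun j _ => ?_
    rw [ha i j]; ring
  have tb : ∑ i, ∑ j, b j i * θ * dm i j = (∑ i, ∑ j, b j i * dm i j) * θ := by
    simp only [Finset.sum_mul]
    refine Finset.sum_congr rfl fun i _ => Finset.sum_congr rfl fun j _ => ?_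
    ring
  have td : ∑ i, ∑ j, d i j * m j * dθ i = ∑ i, (∑ j, d i j * dθ j) * m i := by
    rw [Finset.sum_comm]
    simp only [Finset.sum_mul]
    refine Finset.sum_congr rfl fun i _ => Finset.sum_congr rfl fun j _ => ?_
    rw [hd i j]; ring
  have tK : ∑ i, ∑ j, K i j * dτ j * dθ i = ∑ i, ∑ j, K i j * dθ i * dτ j :=
    Finset.sum_congr rfl fun i _ => Finset.sum_congr rfl fun j _ => by ring
  have tKt : ∑ i, ∑ j, Kt i j * dθ j * dθ i = ∑ i, ∑ j, Kt i j * dθ i * dθ j :=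
    Finset.sum_congr rfl fun i _ => Finset.sum_congr rfl fun j _ => by ring
  have tc : ∑ i, (∑ j, cT i j * m' j) * m i = ∑ i, ∑ j, cT i j * m' i * m j := by
    rw [Finset.sum_comm]
    simp only [Finset.sum_mul]
    refine Finset.sum_congr rfl fun i _ => Finset.sum_congr rfl fun j _ => ?_
    rw [hcT i j]
  simp only [add_mul, sub_mul, mul_add, Finset.sum_add_distrib, Finset.sum_sub_distrib,
    Finset.sum_neg_distrib, tA, tB₁, tB₂, tC, tCt, ta, tb, td, tK, tKt, tc]
  ring

/-! ### Projections and norms on six-fold products. -/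

section Products

variable {A B C D E F : Type*} [NormedAddCommGroup A] [NormedSpace ℝ A] [NormedAddCommGroup B]
  [NormedSpace ℝ B] [NormedAddCommGroup C] [NormedSpace ℝ C] [NormedAddCommGroup D]
  [NormedSpace ℝ D] [NormedAddCommGroup E] [NormedSpace ℝ E] [NormedAddCommGroup F]
  [NormedSpace ℝ F]

theorem isBoundedLinearMap_apply {ι : Type*} [Fintype ι] (i : ι) :
    IsBoundedLinearMap ℝ (fun x : ι → A => x i) :=
  (ContinuousLinearMap.proj (R := ℝ) (φ := fun _ : ι => A) i).isBoundedLinearMap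

theorem isBoundedLinearMap_proj₁ :
    IsBoundedLinearMap ℝ (fun x : A × B × C × D × E × F => x.1) := .fst

theorem isBoundedLinearMap_proj₂ :
    IsBoundedLinearMap ℝ (fun x : A × B × C × D × E × F => x.2.1) :=
  .comp (g := fun x : B × C × D × E × F => x.1) .fst .snd

theorem isBoundedLinearMap_proj₃ :
    IsBoundedLinearMap ℝ (fun x : A × B × C × D × E × F => x.2.2.1) :=
  .comp (g := fun x : C × D × E × F => x.1) .fst
    (.comp (g := fun x : B × C × D × E × F => x.2) .snd .snd)

theorem isBoundedLinearMap_proj₄ :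
    IsBoundedLinearMap ℝ (fun x : A × B × C × D × E × F => x.2.2.2.1) :=
  .comp (g := fun x : C × D × E × F => x.2.1)
    (.comp (g := fun x : D × E × F => x.1) .fst .snd)
    (.comp (g := fun x : B × C × D × E × F => x.2) .snd .snd)

theorem isBoundedLinearMap_proj₅ :
    IsBoundedLinearMap ℝ (fun x : A × B × C × D × E × F => x.2.2.2.2.1) :=
  .comp (g := fun x : C × D × E × F => x.2.2.1)
    (.comp (g := fun x : D × E × F => x.2.1)
      (.comp (g := fun x : E × F => x.1) .fst .snd) .snd)
    (.comp (g := fun x : B × C × D × E × F => x.2) .snd .snd)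

theorem isBoundedLinearMap_proj₆ :
    IsBoundedLinearMap ℝ (fun x : A × B × C × D × E × F => x.2.2.2.2.2) :=
  .comp (g := fun x : C × D × E × F => x.2.2.2)
    (.comp (g := fun x : D × E × F => x.2.2)
      (.comp (g := fun x : E × F => x.2) .snd .snd) .snd)
    (.comp (g := fun x : B × C × D × E × F => x.2) .snd .snd)

omit [NormedSpace ℝ A] [NormedSpace ℝ B] [NormedSpace ℝ C] [NormedSpace ℝ D] [NormedSpace ℝ E]
  [NormedSpace ℝ F] in
theorem norm_prod6_le {x : A × B × C × D × E × F} {r : ℝ} (h₁ : ‖x.1‖ ≤ r) (h₂ : ‖x.2.1‖ ≤ r)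
    (h₃ : ‖x.2.2.1‖ ≤ r) (h₄ : ‖x.2.2.2.1‖ ≤ r) (h₅ : ‖x.2.2.2.2.1‖ ≤ r)
    (h₆ : ‖x.2.2.2.2.2‖ ≤ r) : ‖x‖ ≤ r :=
  norm_prod_le_iff.mpr ⟨h₁, norm_prod_le_iff.mpr ⟨h₂, norm_prod_le_iff.mpr ⟨h₃,
    norm_prod_le_iff.mpr ⟨h₄, norm_prod_le_iff.mpr ⟨h₅, h₆⟩⟩⟩⟩⟩

-- The grouping into velocities and displacements matches the kinetic and stored-energy lower bounds
-- to be added later.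
omit [NormedSpace ℝ A] [NormedSpace ℝ B] [NormedSpace ℝ C] [NormedSpace ℝ D] [NormedSpace ℝ E]
  [NormedSpace ℝ F] in
theorem norm_sq_prod6_le {ι : Type*} [Fintype ι] (u : ι → A) (v : ι → B) (τ : C) (θ : D)
    (R : ι → E) (M : ι → F) :
    ‖(u, v, τ, θ, R, M)‖ ^ 2 ≤ ((∑ i, ‖v i‖ ^ 2) + ‖θ‖ ^ 2 + ∑ i, ‖M i‖ ^ 2)
      + ((∑ i, ‖u i‖ ^ 2) + ‖τ‖ ^ 2 + ∑ i, ‖R i‖ ^ 2) := by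
  set S := ((∑ i, ‖v i‖ ^ 2) + ‖θ‖ ^ 2 + ∑ i, ‖M i‖ ^ 2)
      + ((∑ i, ‖u i‖ ^ 2) + ‖τ‖ ^ 2 + ∑ i, ‖R i‖ ^ 2) with hS
  have nv : 0 ≤ ∑ i, ‖v i‖ ^ 2 := by positivity
  have nM : 0 ≤ ∑ i, ‖M i‖ ^ 2 := by positivity
  have nu : 0 ≤ ∑ i, ‖u i‖ ^ 2 := by positivity
  have nR : 0 ≤ ∑ i, ‖R i‖ ^ 2 := by positivity
  have nθ := sq_nonneg ‖θ‖
  have nτ := sq_nonneg ‖τ‖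
  have hS0 : 0 ≤ S := by positivity
  have hle : ∀ r : ℝ, r ^ 2 ≤ S → r ≤ √S := fun r hr => Real.le_sqrt_of_sq_le hr
  have single : ∀ (f : ι → ℝ) (i : ι), f i ^ 2 ≤ ∑ i, f i ^ 2 := fun f i =>
    Finset.single_le_sum (f := fun i => f i ^ 2) (fun _ _ => sq_nonneg _) (Finset.mem_univ i)
  have h : ‖(u, v, τ, θ, R, M)‖ ≤ √S := by
    refine norm_prod6_le ?_ ?_ (hle _ (by linarith)) (hle _ (by linarith)) ?_ ?_ <;>
      refine (pi_norm_le_iff_of_nonneg (Real.sqrt_nonneg _)).mpr fun i => hle _ ?_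
    · linarith [single (fun i => ‖u i‖) i]
    · linarith [single (fun i => ‖v i‖) i]
    · linarith [single (fun i => ‖R i‖) i]
    · linarith [single (fun i => ‖M i‖) i]
  calc ‖(u, v, τ, θ, R, M)‖ ^ 2 ≤ √S ^ 2 := by gcongr
    _ = S := Real.sq_sqrt hS0

end Products

/-! ### The components of a state as bounded linear maps. -/

section StateComponents

variable {Ω : Opens E3}

theorem isL2Linear_W0_fn : IsL2Linear (vol Ω) (fun w : W0 Ω => (w.fn : E3 → ℝ)) :=
  .of_bounded (fnL Ω).isBoundedLinearMap

theorem isL2Linear_W0_d (j : Fin 3) : IsL2Linear (vol Ω) (fun w : W0 Ω => (w.d j : E3 → ℝ)) :=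
  .of_bounded (dL Ω j).isBoundedLinearMap

theorem isBoundedLinearMap_u : IsBoundedLinearMap ℝ (fun U : State Ω => U.u) :=
  isBoundedLinearMap_proj₁ (A := Fin 3 → W0 Ω) (B := Fin 3 → L2 Ω) (C := W0 Ω) (D := L2 Ω)
    (E := Fin 3 → W0 Ω) (F := Fin 3 → L2 Ω)

theorem isBoundedLinearMap_v : IsBoundedLinearMap ℝ (fun U : State Ω => U.v) :=
  isBoundedLinearMap_proj₂ (A := Fin 3 → W0 Ω) (B := Fin 3 → L2 Ω) (C := W0 Ω) (D := L2 Ω)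
    (E := Fin 3 → W0 Ω) (F := Fin 3 → L2 Ω)

theorem isBoundedLinearMap_τ : IsBoundedLinearMap ℝ (fun U : State Ω => U.τ) :=
  isBoundedLinearMap_proj₃ (A := Fin 3 → W0 Ω) (B := Fin 3 → L2 Ω) (C := W0 Ω) (D := L2 Ω)
    (E := Fin 3 → W0 Ω) (F := Fin 3 → L2 Ω)

theorem isBoundedLinearMap_θ : IsBoundedLinearMap ℝ (fun U : State Ω => U.θ) :=
  isBoundedLinearMap_proj₄ (A := Fin 3 → W0 Ω) (B := Fin 3 → L2 Ω) (C := W0 Ω) (D := L2 Ω)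
    (E := Fin 3 → W0 Ω) (F := Fin 3 → L2 Ω)

theorem isBoundedLinearMap_R : IsBoundedLinearMap ℝ (fun U : State Ω => U.R) :=
  isBoundedLinearMap_proj₅ (A := Fin 3 → W0 Ω) (B := Fin 3 → L2 Ω) (C := W0 Ω) (D := L2 Ω)
    (E := Fin 3 → W0 Ω) (F := Fin 3 → L2 Ω)

theorem isBoundedLinearMap_M : IsBoundedLinearMap ℝ (fun U : State Ω => U.M) :=
  isBoundedLinearMap_proj₆ (A := Fin 3 → W0 Ω) (B := Fin 3 → L2 Ω) (C := W0 Ω) (D := L2 Ω)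
    (E := Fin 3 → W0 Ω) (F := Fin 3 → L2 Ω)

theorem isL2Linear_apply (i : Fin 3) :
    IsL2Linear (vol Ω) (fun v : Fin 3 → L2 Ω => (v i : E3 → ℝ)) :=
  .of_bounded (isBoundedLinearMap_apply i)

theorem isBoundedLinearMap_apply_W0 (i : Fin 3) :
    IsBoundedLinearMap ℝ (fun w : Fin 3 → W0 Ω => w i) :=
  isBoundedLinearMap_apply i

theorem isL2Linear_apply_d (i j : Fin 3) :
    IsL2Linear (vol Ω) (fun u : Fin 3 → W0 Ω => ((u i).d j : E3 → ℝ)) :=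
  (isL2Linear_W0_d (Ω := Ω) j).comp (isBoundedLinearMap_apply_W0 (Ω := Ω) i)

theorem isL2Linear_u_d (i j : Fin 3) :
    IsL2Linear (vol Ω) (fun U : State Ω => ((U.u i).d j : E3 → ℝ)) :=
  (isL2Linear_apply_d (Ω := Ω) i j).comp (isBoundedLinearMap_u (Ω := Ω))

theorem isL2Linear_v (i : Fin 3) : IsL2Linear (vol Ω) (fun U : State Ω => (U.v i : E3 → ℝ)) :=
  (isL2Linear_apply (Ω := Ω) i).comp (isBoundedLinearMap_v (Ω := Ω))

theorem isL2Linear_τ_d (j : Fin 3) :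
    IsL2Linear (vol Ω) (fun U : State Ω => (U.τ.d j : E3 → ℝ)) :=
  (isL2Linear_W0_d (Ω := Ω) j).comp (isBoundedLinearMap_τ (Ω := Ω))

theorem isL2Linear_θ : IsL2Linear (vol Ω) (fun U : State Ω => (U.θ : E3 → ℝ)) :=
  .of_bounded (isBoundedLinearMap_θ (Ω := Ω))

theorem isL2Linear_R_d (i j : Fin 3) :
    IsL2Linear (vol Ω) (fun U : State Ω => ((U.R i).d j : E3 → ℝ)) :=
  (isL2Linear_apply_d (Ω := Ω) i j).comp (isBoundedLinearMap_R (Ω := Ω))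

theorem isL2Linear_M (i : Fin 3) : IsL2Linear (vol Ω) (fun U : State Ω => (U.M i : E3 → ℝ)) :=
  (isL2Linear_apply (Ω := Ω) i).comp (isBoundedLinearMap_M (Ω := Ω))

theorem isL2Linear_strain (i j : Fin 3) :
    IsL2Linear (vol Ω) (fun U : State Ω => strain U.u i j) :=
  ((isL2Linear_u_d (Ω := Ω) i j).add (isL2Linear_u_d j i)).const_mul (1 / 2)

end StateComponents

/-! ### The energy product and its equivalence with the product norm. -/

namespace Coefficients

variable {κ : Coefficients} {Ω : Opens E3}

/-- The density of the stored-energy part of the energy product. -/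
theorem isL1Bilinear_twoW (hb : κ.Bounded Ω) : IsL1Bilinear (vol Ω)
    (fun U U' : State Ω => κ.twoW U.u U.τ U.R U'.u U'.τ U'.R) := by
  refine IsL1Bilinear.add
    (.sum _ fun i => .sum _ fun j => .sum _ fun k => .sum _ fun l => .add (.add ?_ ?_) ?_)
    (.sum _ fun i => .sum _ fun j => ?_)
  · exact .mul (.Linfty_mul (hb.A i j k l) (isL2Linear_strain k l)) (isL2Linear_strain i j)
  · exact .Linfty_mul (hb.B i j k l) (.add (.mul (isL2Linear_strain i j) (isL2Linear_R_d k l))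
      (.mul_swap (isL2Linear_strain i j) (isL2Linear_R_d k l)))
  · exact .mul (.Linfty_mul (hb.C i j k l) (isL2Linear_R_d i j)) (isL2Linear_R_d k l)
  · exact .mul (.Linfty_mul (hb.K i j) (isL2Linear_τ_d i)) (isL2Linear_τ_d j)

/-- The density of the kinetic part of the energy product. -/
def kineticDensity (κ : Coefficients) (U U' : State Ω) (x : E3) : ℝ :=
  (∑ i, κ.ρ x * U.v i x * U'.v i x) + κ.c x * U.θ x * U'.θ x
    + ∑ i, ∑ j, κ.cT i j x * U.M i x * U'.M j x

theorem isL1Bilinear_kineticDensity (hb : κ.Bounded Ω) : IsL1Bilinear (vol Ω)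
    (fun U U' : State Ω => κ.kineticDensity U U') := by
  refine IsL1Bilinear.add (.add (.sum _ fun i => ?_) ?_) (.sum _ fun i => .sum _ fun j => ?_)
  · exact .mul (.Linfty_mul hb.ρ (isL2Linear_v i)) (isL2Linear_v i)
  · exact .mul (.Linfty_mul hb.c isL2Linear_θ) isL2Linear_θ
  · exact .mul (.Linfty_mul (hb.cT i j) (isL2Linear_M i)) (isL2Linear_M j)

/-- The density of the energy product. -/
def energyDensity (κ : Coefficients) (U U' : State Ω) (x : E3) : ℝ :=
  κ.kineticDensity U U' x + κ.twoW U.u U.τ U.R U'.u U'.τ U'.R x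

theorem isL1Bilinear_energyDensity (hb : κ.Bounded Ω) : IsL1Bilinear (vol Ω)
    (fun U U' : State Ω => κ.energyDensity U U') :=
  (isL1Bilinear_kineticDensity hb).add (isL1Bilinear_twoW hb)

theorem energyInner_eq (U U' : State Ω) :
    κ.energyInner U U' = (1 / 2) * ∫ x in (Ω : Set E3), κ.energyDensity U U' x := rfl

/-- The `B`-term is symmetric in the two states as it stands; `A` and `C` need the exchange of index
pairs, `cT` and `K` the exchange of indices. -/
theorem energyDensity_symm (hs : κ.Symmetric Ω) (U U' : State Ω) :
    κ.energyDensity U U' =ᵐ[vol Ω] κ.energyDensity U' U := by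
  filter_upwards [hs] with x hx
  have hA : ∀ i j k l, κ.A i j k l x = κ.A k l i j x := fun i j k l =>
    ((hx i j).2.2.2.2.2.2 k l).2.1
  have hC : ∀ i j k l, κ.C i j k l x = κ.C k l i j x := fun i j k l =>
    ((hx i j).2.2.2.2.2.2 k l).2.2.2.2.2.1
  have tM : ∑ i, ∑ j, κ.cT i j x * U.M i x * U'.M j x
      = ∑ i, ∑ j, κ.cT i j x * U'.M i x * U.M j x := by
    rw [Finset.sum_comm]
    refine Finset.sum_congr rfl fun i _ => Finset.sum_congr rfl fun j _ => ?_
    rw [(hx j i).2.2.2.1]; ring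
  have tK : ∑ i, ∑ j, κ.K i j x * U.τ.d i x * U'.τ.d j x
      = ∑ i, ∑ j, κ.K i j x * U'.τ.d i x * U.τ.d j x := by
    rw [Finset.sum_comm]
    refine Finset.sum_congr rfl fun i _ => Finset.sum_congr rfl fun j _ => ?_
    rw [(hx j i).2.2.2.2.1]; ring
  have tA : ∑ i, ∑ j, ∑ k, ∑ l, κ.A i j k l x * strain U.u k l x * strain U'.u i j x
      = ∑ i, ∑ j, ∑ k, ∑ l, κ.A i j k l x * strain U'.u k l x * strain U.u i j x := by
    rw [sum4_swap_pairs]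
    refine Finset.sum_congr rfl fun i _ => Finset.sum_congr rfl fun j _ =>
      Finset.sum_congr rfl fun k _ => Finset.sum_congr rfl fun l _ => ?_
    rw [← hA]; ring
  have tC : ∑ i, ∑ j, ∑ k, ∑ l, κ.C i j k l x * (U.R i).d j x * (U'.R k).d l x
      = ∑ i, ∑ j, ∑ k, ∑ l, κ.C i j k l x * (U'.R i).d j x * (U.R k).d l x := by
    rw [sum4_swap_pairs]
    refine Finset.sum_congr rfl fun i _ => Finset.sum_congr rfl fun j _ =>
      Finset.sum_congr rfl fun k _ => Finset.sum_congr rfl fun l _ => ?_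
    rw [← hC]; ring
  have tv : ∑ i, κ.ρ x * U.v i x * U'.v i x = ∑ i, κ.ρ x * U'.v i x * U.v i x :=
    Finset.sum_congr rfl fun i _ => by ring
  simp only [energyDensity, kineticDensity, twoW, mul_add, Finset.sum_add_distrib, tA, tK, tC, tM,
    tv]
  ring

theorem integral_sq_eq {f : L2 Ω} : ∫ x in (Ω : Set E3), f x ^ 2 = ‖f‖ ^ 2 := by
  rw [← real_inner_self_eq_norm_sq, inner_L2_eq EventuallyEq.rfl EventuallyEq.rfl]
  simp only [sq]

theorem integrable_sq (f : L2 Ω) : Integrable (fun x => f x ^ 2) (vol Ω) :=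
  (Lp.memLp f).integrable_sq

theorem kinetic_lower_bound (hb : κ.Bounded Ω) {γ : ℝ}
    (h : ∀ᵐ x ∂(vol Ω), γ ≤ κ.ρ x ∧ γ ≤ κ.c x ∧
      ∀ ξ : Fin 3 → ℝ, γ * ∑ i, ξ i ^ 2 ≤ ∑ i, ∑ j, κ.cT i j x * ξ i * ξ j) (U : State Ω) :
    γ * ((∑ i, ‖U.v i‖ ^ 2) + ‖U.θ‖ ^ 2 + ∑ i, ‖U.M i‖ ^ 2)
      ≤ ∫ x in (Ω : Set E3), κ.kineticDensity U U x := by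
  have hv : Integrable (fun x => ∑ i, U.v i x ^ 2) (vol Ω) :=
    integrable_finsetSum _ fun i _ => integrable_sq _
  have hM : Integrable (fun x => ∑ i, U.M i x ^ 2) (vol Ω) :=
    integrable_finsetSum _ fun i _ => integrable_sq _
  have e : ∫ x in (Ω : Set E3), γ * ((∑ i, U.v i x ^ 2) + U.θ x ^ 2 + ∑ i, U.M i x ^ 2)
      = γ * ((∑ i, ‖U.v i‖ ^ 2) + ‖U.θ‖ ^ 2 + ∑ i, ‖U.M i‖ ^ 2) := by
    have hvθ : Integrable (fun x => (∑ i, U.v i x ^ 2) + U.θ x ^ 2) (vol Ω) :=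
      hv.add (integrable_sq _)
    rw [integral_const_mul, integral_add hvθ hM,
      integral_add hv (integrable_sq _), integral_finsetSum _ fun i _ => integrable_sq _,
      integral_finsetSum _ fun i _ => integrable_sq _]
    simp only [integral_sq_eq]
  rw [← e]
  refine integral_mono_ae (((hv.add (integrable_sq _)).add hM).const_mul γ)
    ((isL1Bilinear_kineticDensity hb).integrable U U) ?_
  filter_upwards [h] with x hx
  have h1 : γ * ∑ i, U.v i x ^ 2 ≤ ∑ i, κ.ρ x * U.v i x * U.v i x := by
    rw [Finset.mul_sum]
    refine Finset.sum_le_sum fun i _ => ?_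
    nlinarith [mul_le_mul_of_nonneg_right hx.1 (sq_nonneg (U.v i x))]
  have h2 : γ * U.θ x ^ 2 ≤ κ.c x * U.θ x * U.θ x := by
    nlinarith [mul_le_mul_of_nonneg_right hx.2.1 (sq_nonneg (U.θ x))]
  have h3 := hx.2.2 fun i => U.M i x
  simp only [kineticDensity, mul_add]
  linarith

/-- Korn's inequality upgrades strains to full gradients, at the cost of half the coercivity
constant. -/
theorem twoW_lower_bound {c₀ : ℝ} (hc₀ : 0 < c₀)
    (h : ∀ (u : Fin 3 → W0 Ω) (τ : W0 Ω) (R : Fin 3 → W0 Ω),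
      c₀ * ∫ x in (Ω : Set E3), ((∑ i, ∑ j, strain u i j x ^ 2) + (∑ i, τ.d i x ^ 2)
        + ∑ i, ∑ j, (R i).d j x ^ 2)
      ≤ ∫ x in (Ω : Set E3), κ.twoW u τ R u τ R x) (u : Fin 3 → W0 Ω) (τ : W0 Ω)
    (R : Fin 3 → W0 Ω) :
    c₀ / 2 * ((∑ i, ∑ j, ‖(u i).d j‖ ^ 2) + (∑ j, ‖τ.d j‖ ^ 2) + ∑ i, ∑ j, ‖(R i).d j‖ ^ 2)
      ≤ ∫ x in (Ω : Set E3), κ.twoW u τ R u τ R x := by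
  refine le_trans ?_ (h u τ R)
  set E : Fin 3 → Fin 3 → L2 Ω := fun i j => (1 / 2 : ℝ) • ((u i).d j + (u j).d i) with hE
  have hEs : ∀ i j, (fun x => strain u i j x ^ 2) =ᵐ[vol Ω] fun x => E i j x ^ 2 := by
    intro i j
    filter_upwards [Lp.coeFn_smul (1 / 2 : ℝ) ((u i).d j + (u j).d i),
      Lp.coeFn_add ((u i).d j) ((u j).d i)] with x h1 h2
    rw [hE, h1, Pi.smul_apply, h2]
    rfl
  have iE : ∀ i j, Integrable (fun x => strain u i j x ^ 2) (vol Ω) := fun i j =>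
    (integrable_congr (hEs i j)).mpr (integrable_sq _)
  have i1 : Integrable (fun x => ∑ i, ∑ j, strain u i j x ^ 2) (vol Ω) :=
    integrable_finsetSum _ fun i _ => integrable_finsetSum _ fun j _ => iE i j
  have i2 : Integrable (fun x => ∑ i, τ.d i x ^ 2) (vol Ω) :=
    integrable_finsetSum _ fun i _ => integrable_sq _
  have i3 : Integrable (fun x => ∑ i, ∑ j, (R i).d j x ^ 2) (vol Ω) :=
    integrable_finsetSum _ fun i _ => integrable_finsetSum _ fun j _ => integrable_sq _
  have e1 : ∫ x in (Ω : Set E3), ∑ i, ∑ j, strain u i j x ^ 2 = ∑ i, ∑ j, ‖E i j‖ ^ 2 := by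
    rw [integral_finsetSum _ fun i _ => integrable_finsetSum _ fun j _ => iE i j]
    refine Finset.sum_congr rfl fun i _ => ?_
    rw [integral_finsetSum _ fun j _ => iE i j]
    refine Finset.sum_congr rfl fun j _ => ?_
    rw [integral_congr_ae (hEs i j), integral_sq_eq]
  have e2 : ∫ x in (Ω : Set E3), ∑ i, τ.d i x ^ 2 = ∑ i, ‖τ.d i‖ ^ 2 := by
    rw [integral_finsetSum _ fun i _ => integrable_sq _]
    simp only [integral_sq_eq]
  have e3 : ∫ x in (Ω : Set E3), ∑ i, ∑ j, (R i).d j x ^ 2 = ∑ i, ∑ j, ‖(R i).d j‖ ^ 2 := by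
    rw [integral_finsetSum _ fun i _ => integrable_finsetSum _ fun j _ => integrable_sq _]
    refine Finset.sum_congr rfl fun i _ => ?_
    rw [integral_finsetSum _ fun j _ => integrable_sq _]
    simp only [integral_sq_eq]
  have i12 : Integrable (fun x => (∑ i, ∑ j, strain u i j x ^ 2) + ∑ i, τ.d i x ^ 2) (vol Ω) :=
    i1.add i2
  rw [integral_add i12 i3, integral_add i1 i2, e1, e2, e3]
  have hk := korn u
  have n2 : 0 ≤ ∑ j, ‖τ.d j‖ ^ 2 := Finset.sum_nonneg fun _ _ => sq_nonneg _
  have n3 : 0 ≤ ∑ i, ∑ j, ‖(R i).d j‖ ^ 2 :=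
    Finset.sum_nonneg fun _ _ => Finset.sum_nonneg fun _ _ => sq_nonneg _
  have h5 : (1 / 2) * ((∑ i, ∑ j, ‖(u i).d j‖ ^ 2) + (∑ j, ‖τ.d j‖ ^ 2)
      + ∑ i, ∑ j, ‖(R i).d j‖ ^ 2) ≤ (∑ i, ∑ j, ‖E i j‖ ^ 2) + (∑ i, ‖τ.d i‖ ^ 2)
      + ∑ i, ∑ j, ‖(R i).d j‖ ^ 2 := by linarith
  have h6 := mul_le_mul_of_nonneg_left h5 hc₀.le
  linarith

theorem exists_norm_sq_W0_le (hΩ : Bornology.IsBounded (Ω : Set E3)) :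
    ∃ C : ℝ, 0 < C ∧ ∀ w : W0 Ω, ‖w‖ ^ 2 ≤ C * ∑ j, ‖w.d j‖ ^ 2 := by
  obtain ⟨C, hC, h⟩ := exists_poincare hΩ
  -- Here `3` is Cauchy–Schwarz over three partial derivatives, and `1` accounts for the gradient
  -- part of the norm.
  refine ⟨C ^ 2 * 3 + 1, by positivity, fun w => ?_⟩
  have h1 : ‖w.fn‖ ^ 2 ≤ C ^ 2 * (∑ j, ‖w.d j‖) ^ 2 := by
    rw [← mul_pow]
    exact pow_le_pow_left₀ (norm_nonneg _) (h w) 2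
  have h2 : (∑ j, ‖w.d j‖) ^ 2 ≤ 3 * ∑ j, ‖w.d j‖ ^ 2 := by
    simpa using sq_sum_le_card_mul_sum_sq (s := (Finset.univ : Finset (Fin 3)))
      (f := fun j => ‖w.d j‖)
  rw [norm_sq_W0]
  nlinarith [mul_le_mul_of_nonneg_left h2 (sq_nonneg C)]

theorem isEquivalentInner_energyInner (hΩ : Bornology.IsBounded (Ω : Set E3))
    (hb : κ.Bounded Ω) (hp : κ.Positive Ω) (hs : κ.Symmetric Ω) (hc : κ.Coercive Ω) :
    IsEquivalentInner (fun U V : State Ω => κ.energyInner U V) where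
  symm := fun U V => by
    rw [energyInner_eq, energyInner_eq, integral_congr_ae (energyDensity_symm hs U V)]
  add_left := fun U V W => by
    simp only [energyInner_eq]
    rw [(isL1Bilinear_energyDensity hb).integral_add_left, mul_add]
  smul_left := fun r U V => by
    simp only [energyInner_eq]
    rw [(isL1Bilinear_energyDensity hb).integral_smul_left]
    ring
  equiv := by
    obtain ⟨γ, hγ, hpos⟩ := hp
    obtain ⟨c₀, hc₀, hco⟩ := hc
    obtain ⟨C, hC, hCW⟩ := exists_norm_sq_W0_le hΩ
    -- The velocities contribute `γ`; the displacements contribute `c₀ / 2` after Korn, divided by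
    -- the Poincaré constant. The further halving below is the factor `1/2` in the energy.
    set m := min γ (c₀ / 2 / C) with hm
    have hm0 : 0 < m := lt_min hγ (by positivity)
    obtain ⟨N, hN, hup⟩ := (isL1Bilinear_energyDensity hb).integral_le
    refine ⟨m / 2, by positivity, N / 2, by positivity, fun U => ⟨?_, ?_⟩⟩
    · have h1 := kinetic_lower_bound hb hpos U
      have h2 := twoW_lower_bound hc₀ hco U.u U.τ U.R
      have h3 : κ.energyInner U U = (1 / 2) * ((∫ x in (Ω : Set E3), κ.kineticDensity U U x)
          + ∫ x in (Ω : Set E3), κ.twoW U.u U.τ U.R U.u U.τ U.R x) := by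
        rw [energyInner_eq, ← integral_add ((isL1Bilinear_kineticDensity hb).integrable U U)
          ((isL1Bilinear_twoW hb).integrable U U)]
        rfl
      have h4 : ‖U‖ ^ 2 ≤ _ := norm_sq_prod6_le U.u U.v U.τ U.θ U.R U.M
      set P := (∑ i, ‖U.v i‖ ^ 2) + ‖U.θ‖ ^ 2 + ∑ i, ‖U.M i‖ ^ 2 with hP
      set Q := (∑ i, ‖U.u i‖ ^ 2) + ‖U.τ‖ ^ 2 + ∑ i, ‖U.R i‖ ^ 2 with hQ
      set D := (∑ i, ∑ j, ‖(U.u i).d j‖ ^ 2) + (∑ j, ‖U.τ.d j‖ ^ 2)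
        + ∑ i, ∑ j, ‖(U.R i).d j‖ ^ 2 with hD
      have hP0 : 0 ≤ P := by positivity
      have hQ0 : 0 ≤ Q := by positivity
      have hQD : Q ≤ C * D := by
        rw [hQ, hD, mul_add, mul_add, Finset.mul_sum Finset.univ, Finset.mul_sum Finset.univ
          (fun i => ∑ j, ‖(U.R i).d j‖ ^ 2)]
        exact add_le_add_three (Finset.sum_le_sum fun i _ => hCW _) (hCW _)
          (Finset.sum_le_sum fun i _ => hCW _)
      have h5 : m * P ≤ γ * P := by gcongr; exact min_le_left _ _
      have h6 : m * Q ≤ c₀ / 2 * D := by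
        calc m * Q ≤ c₀ / 2 / C * (C * D) := by
              gcongr
              exact min_le_right _ _
          _ = c₀ / 2 * D := by field_simp
      change m / 2 * ‖U‖ ^ 2 ≤ κ.energyInner U U
      have h7 := mul_le_mul_of_nonneg_left h4 hm0.le
      rw [h3]
      linarith [mul_add m P Q]
    · rw [energyInner_eq]
      linarith [hup U]

end Coefficients

/-! ### Weak formulation of the operator and the energy inequality. -/

section WeakForm

variable {Ω : Opens E3}

/-- An equation that holds against all test functions holds against all of `W₀^{1,2}(Ω)`. -/
theorem forall_test_iff {X : Type*} [NormedAddCommGroup X] [NormedSpace ℝ X]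
    {L R : X → W0 Ω → E3 → ℝ} (hL : IsL1Bilinear (vol Ω) L) (hR : IsL1Bilinear (vol Ω) R) {p : X}
    {L' R' : 𝓓(Ω, ℝ) → E3 → ℝ} (hL' : ∀ φ, L' φ =ᵐ[vol Ω] L p (testJet φ))
    (hR' : ∀ φ, R' φ =ᵐ[vol Ω] R p (testJet φ)) :
    (∀ φ, ∫ x in (Ω : Set E3), L' φ x = ∫ x in (Ω : Set E3), R' φ x) ↔
      ∀ w, ∫ x in (Ω : Set E3), (L p w x - R p w x) = 0 := by
  have key : ∀ φ, (∫ x in (Ω : Set E3), L' φ x = ∫ x in (Ω : Set E3), R' φ x) ↔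
      ∫ x in (Ω : Set E3), (L p (testJet φ) x - R p (testJet φ) x) = 0 := by
    intro φ
    rw [integral_congr_ae (hL' φ), integral_congr_ae (hR' φ),
      integral_sub (hL.integrable p _) (hR.integrable p _), sub_eq_zero]
  simp only [key]
  exact ⟨fun h w => (hL.sub hR).integral_eq_zero_of_denseRange denseRange_testJet h w,
    fun h φ => h _⟩

instance : NormedSpace ℝ (State Ω × State Ω) := Prod.normedSpace

theorem isBoundedLinearMap_fst_state :
    IsBoundedLinearMap ℝ (fun p : State Ω × State Ω => p.1) := .fst

theorem isBoundedLinearMap_snd_state :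
    IsBoundedLinearMap ℝ (fun p : State Ω × State Ω => p.2) := .snd

theorem isL2Linear_fst_u_d (i j : Fin 3) :
    IsL2Linear (vol Ω) (fun p : State Ω × State Ω => ((p.1.u i).d j : E3 → ℝ)) :=
  (isL2Linear_u_d (Ω := Ω) i j).comp (isBoundedLinearMap_fst_state (Ω := Ω))

theorem isL2Linear_snd_u_d (i j : Fin 3) :
    IsL2Linear (vol Ω) (fun p : State Ω × State Ω => ((p.2.u i).d j : E3 → ℝ)) :=
  (isL2Linear_u_d (Ω := Ω) i j).comp (isBoundedLinearMap_snd_state (Ω := Ω))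

theorem isL2Linear_snd_v (i : Fin 3) :
    IsL2Linear (vol Ω) (fun p : State Ω × State Ω => (p.2.v i : E3 → ℝ)) :=
  (isL2Linear_v (Ω := Ω) i).comp (isBoundedLinearMap_snd_state (Ω := Ω))

theorem isL2Linear_fst_τ_d (j : Fin 3) :
    IsL2Linear (vol Ω) (fun p : State Ω × State Ω => (p.1.τ.d j : E3 → ℝ)) :=
  (isL2Linear_τ_d (Ω := Ω) j).comp (isBoundedLinearMap_fst_state (Ω := Ω))

theorem isL2Linear_snd_τ_d (j : Fin 3) :
    IsL2Linear (vol Ω) (fun p : State Ω × State Ω => (p.2.τ.d j : E3 → ℝ)) :=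
  (isL2Linear_τ_d (Ω := Ω) j).comp (isBoundedLinearMap_snd_state (Ω := Ω))

theorem isL2Linear_fst_θ :
    IsL2Linear (vol Ω) (fun p : State Ω × State Ω => (p.1.θ : E3 → ℝ)) :=
  (isL2Linear_θ (Ω := Ω)).comp (isBoundedLinearMap_fst_state (Ω := Ω))

theorem isL2Linear_snd_θ :
    IsL2Linear (vol Ω) (fun p : State Ω × State Ω => (p.2.θ : E3 → ℝ)) :=
  (isL2Linear_θ (Ω := Ω)).comp (isBoundedLinearMap_snd_state (Ω := Ω))

theorem isL2Linear_fst_R_d (i j : Fin 3) :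
    IsL2Linear (vol Ω) (fun p : State Ω × State Ω => ((p.1.R i).d j : E3 → ℝ)) :=
  (isL2Linear_R_d (Ω := Ω) i j).comp (isBoundedLinearMap_fst_state (Ω := Ω))

theorem isL2Linear_snd_R_d (i j : Fin 3) :
    IsL2Linear (vol Ω) (fun p : State Ω × State Ω => ((p.2.R i).d j : E3 → ℝ)) :=
  (isL2Linear_R_d (Ω := Ω) i j).comp (isBoundedLinearMap_snd_state (Ω := Ω))

theorem isL2Linear_fst_M (i : Fin 3) :
    IsL2Linear (vol Ω) (fun p : State Ω × State Ω => (p.1.M i : E3 → ℝ)) :=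
  (isL2Linear_M (Ω := Ω) i).comp (isBoundedLinearMap_fst_state (Ω := Ω))

theorem isL2Linear_snd_M (i : Fin 3) :
    IsL2Linear (vol Ω) (fun p : State Ω × State Ω => (p.2.M i : E3 → ℝ)) :=
  (isL2Linear_M (Ω := Ω) i).comp (isBoundedLinearMap_snd_state (Ω := Ω))

/-- Test velocities: elements of `W₀^{1,2}(Ω)³ × W₀^{1,2}(Ω) × W₀^{1,2}(Ω)³`. -/
abbrev Vel (Ω : Opens E3) : Type := (Fin 3 → W0 Ω) × W0 Ω × (Fin 3 → W0 Ω)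

theorem isBoundedLinearMap_vel_u (i : Fin 3) :
    IsBoundedLinearMap ℝ (fun w : Vel Ω => w.1 i) :=
  .comp (g := fun u : Fin 3 → W0 Ω => u i) (isBoundedLinearMap_apply i) .fst

theorem isBoundedLinearMap_vel_τ : IsBoundedLinearMap ℝ (fun w : Vel Ω => w.2.1) :=
  .comp (g := fun w : W0 Ω × (Fin 3 → W0 Ω) => w.1) .fst .snd

theorem isBoundedLinearMap_vel_R (i : Fin 3) :
    IsBoundedLinearMap ℝ (fun w : Vel Ω => w.2.2 i) :=
  .comp (g := fun u : Fin 3 → W0 Ω => u i) (isBoundedLinearMap_apply i)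
    (.comp (g := fun w : W0 Ω × (Fin 3 → W0 Ω) => w.2) .snd .snd)

namespace Coefficients

/-- Inertial density in the balance of momentum, tested with `f`. -/
def momentumLhs (κ : Coefficients) (i : Fin 3) (p : State Ω × State Ω) (f : E3 → ℝ) (x : E3) : ℝ :=
  κ.ρ x * p.2.v i x * f x

/-- Force density in the balance of momentum, tested with a function of gradient `g`. -/
def momentumRhs (κ : Coefficients) (i : Fin 3) (p : State Ω × State Ω) (g : Fin 3 → E3 → ℝ)
    (x : E3) : ℝ :=
  -∑ j, ((∑ k, ∑ l, κ.A j i k l x * (p.1.u k).d l x) - κ.a j i x * p.1.θ x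
    + ∑ k, ∑ l, κ.B j i k l x * (p.1.R l).d k x) * g j x

/-- Heat capacity density in the balance of energy, tested with `f`. -/
def heatLhs (κ : Coefficients) (p : State Ω × State Ω) (f : E3 → ℝ) (x : E3) : ℝ :=
  κ.c x * p.2.θ x * f x

/-- Heat flux density in the balance of energy, tested with a function `f` of gradient `g`. -/
def heatRhs (κ : Coefficients) (p : State Ω × State Ω) (f : E3 → ℝ) (g : Fin 3 → E3 → ℝ)
    (x : E3) : ℝ :=
  -(∑ i, ∑ j, κ.a i j x * (p.2.u i).d j x) * f x
    - (∑ i, ∑ j, (κ.K i j x * p.1.τ.d j x + κ.Kt i j x * p.2.τ.d j x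
        - κ.d i j x * p.1.M j x) * g i x)
    - (∑ i, ∑ j, κ.b j i x * (p.2.R i).d j x) * f x

/-- Capacity density in the balance of the first moment of energy, tested with `f`. -/
def microLhs (κ : Coefficients) (i : Fin 3) (p : State Ω × State Ω) (f : E3 → ℝ) (x : E3) : ℝ :=
  (∑ j, κ.cT i j x * p.2.M j x) * f x

/-- Flux density in the balance of the first moment of energy, tested with a function `f` of
gradient `g`. -/
def microRhs (κ : Coefficients) (i : Fin 3) (p : State Ω × State Ω) (f : E3 → ℝ)
    (g : Fin 3 → E3 → ℝ) (x : E3) : ℝ :=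
  -(∑ j, ((∑ k, ∑ l, κ.B k l j i x * (p.1.u k).d l x) - κ.b j i x * p.1.θ x
      + (∑ k, ∑ l, κ.C j i k l x * (p.1.R k).d l x)
      + ∑ k, ∑ l, κ.Ct j i k l x * (p.2.R k).d l x) * g j x)
    - (∑ j, κ.d i j x * p.2.τ.d j x) * f x

variable {κ : Coefficients}

theorem isL1Bilinear_momentumLhs (hb : κ.Bounded Ω) (i : Fin 3) : IsL1Bilinear (vol Ω)
    (fun (p : State Ω × State Ω) (w : W0 Ω) => κ.momentumLhs i p w.fn) :=
  .mul (.Linfty_mul hb.ρ (isL2Linear_snd_v (Ω := Ω) i)) (isL2Linear_W0_fn (Ω := Ω))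

theorem isL1Bilinear_momentumRhs (hb : κ.Bounded Ω) (i : Fin 3) : IsL1Bilinear (vol Ω)
    (fun (p : State Ω × State Ω) (w : W0 Ω) => κ.momentumRhs i p fun j => w.d j) := by
  refine .neg (.sum _ fun j => .mul (.add (.sub (.sum _ fun k => .sum _ fun l => ?_) ?_)
    (.sum _ fun k => .sum _ fun l => ?_)) (isL2Linear_W0_d (Ω := Ω) j))
  · exact .Linfty_mul (hb.A j i k l) (isL2Linear_fst_u_d (Ω := Ω) k l)
  · exact .Linfty_mul (hb.a j i) (isL2Linear_fst_θ (Ω := Ω))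
  · exact .Linfty_mul (hb.B j i k l) (isL2Linear_fst_R_d (Ω := Ω) l k)

theorem isL1Bilinear_heatLhs (hb : κ.Bounded Ω) : IsL1Bilinear (vol Ω)
    (fun (p : State Ω × State Ω) (w : W0 Ω) => κ.heatLhs p w.fn) :=
  .mul (.Linfty_mul hb.c (isL2Linear_snd_θ (Ω := Ω))) (isL2Linear_W0_fn (Ω := Ω))

theorem isL1Bilinear_heatRhs (hb : κ.Bounded Ω) : IsL1Bilinear (vol Ω)
    (fun (p : State Ω × State Ω) (w : W0 Ω) => κ.heatRhs p w.fn fun j => w.d j) := by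
  refine .sub (.sub (.mul (.neg (.sum _ fun i => .sum _ fun j => ?_)) (isL2Linear_W0_fn (Ω := Ω)))
    (.sum _ fun i => .sum _ fun j => .mul (.sub (.add ?_ ?_) ?_) (isL2Linear_W0_d (Ω := Ω) i)))
    (.mul (.sum _ fun i => .sum _ fun j => ?_) (isL2Linear_W0_fn (Ω := Ω)))
  · exact .Linfty_mul (hb.a i j) (isL2Linear_snd_u_d (Ω := Ω) i j)
  · exact .Linfty_mul (hb.K i j) (isL2Linear_fst_τ_d (Ω := Ω) j)
  · exact .Linfty_mul (hb.Kt i j) (isL2Linear_snd_τ_d (Ω := Ω) j)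
  · exact .Linfty_mul (hb.d i j) (isL2Linear_fst_M (Ω := Ω) j)
  · exact .Linfty_mul (hb.b j i) (isL2Linear_snd_R_d (Ω := Ω) i j)

theorem isL1Bilinear_microLhs (hb : κ.Bounded Ω) (i : Fin 3) : IsL1Bilinear (vol Ω)
    (fun (p : State Ω × State Ω) (w : W0 Ω) => κ.microLhs i p w.fn) :=
  .mul (.sum _ fun j => .Linfty_mul (hb.cT i j)
    (isL2Linear_snd_M (Ω := Ω) j)) (isL2Linear_W0_fn (Ω := Ω))

theorem isL1Bilinear_microRhs (hb : κ.Bounded Ω) (i : Fin 3) : IsL1Bilinear (vol Ω)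
    (fun (p : State Ω × State Ω) (w : W0 Ω) => κ.microRhs i p w.fn fun j => w.d j) := by
  refine .sub (.neg (.sum _ fun j => .mul (.add (.add (.sub
    (.sum _ fun k => .sum _ fun l => ?_) ?_) (.sum _ fun k => .sum _ fun l => ?_))
    (.sum _ fun k => .sum _ fun l => ?_)) (isL2Linear_W0_d (Ω := Ω) j)))
    (.mul (.sum _ fun j => ?_) (isL2Linear_W0_fn (Ω := Ω)))
  · exact .Linfty_mul (hb.B k l j i) (isL2Linear_fst_u_d (Ω := Ω) k l)
  · exact .Linfty_mul (hb.b j i) (isL2Linear_fst_θ (Ω := Ω))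
  · exact .Linfty_mul (hb.C j i k l) (isL2Linear_fst_R_d (Ω := Ω) k l)
  · exact .Linfty_mul (hb.Ct j i k l) (isL2Linear_snd_R_d (Ω := Ω) k l)
  · exact .Linfty_mul (hb.d i j) (isL2Linear_snd_τ_d (Ω := Ω) j)

/-- Residual density of the balance of momentum. -/
def momentumResidual (κ : Coefficients) (i : Fin 3) (p : State Ω × State Ω) (w : W0 Ω) (x : E3) :
    ℝ :=
  κ.momentumLhs i p w.fn x - κ.momentumRhs i p (fun j => w.d j) x

/-- Residual density of the balance of energy. -/
def heatResidual (κ : Coefficients) (p : State Ω × State Ω) (w : W0 Ω) (x : E3) : ℝ :=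
  κ.heatLhs p w.fn x - κ.heatRhs p w.fn (fun j => w.d j) x

/-- Residual density of the balance of the first moment of energy. -/
def microResidual (κ : Coefficients) (i : Fin 3) (p : State Ω × State Ω) (w : W0 Ω) (x : E3) : ℝ :=
  κ.microLhs i p w.fn x - κ.microRhs i p w.fn (fun j => w.d j) x

/-- Density of the weak form of the three balance laws. -/
def weakDensity (κ : Coefficients) (p : State Ω × State Ω) (w : Vel Ω) (x : E3) : ℝ :=
  (∑ i, κ.momentumResidual i p (w.1 i) x) + κ.heatResidual p w.2.1 x
    + ∑ i, κ.microResidual i p (w.2.2 i) x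

theorem isL1Bilinear_momentumResidual (hb : κ.Bounded Ω) (i : Fin 3) : IsL1Bilinear (vol Ω)
    (fun (p : State Ω × State Ω) (w : W0 Ω) => κ.momentumResidual i p w) :=
  (isL1Bilinear_momentumLhs hb i).sub (isL1Bilinear_momentumRhs hb i)

theorem isL1Bilinear_heatResidual (hb : κ.Bounded Ω) : IsL1Bilinear (vol Ω)
    (fun (p : State Ω × State Ω) (w : W0 Ω) => κ.heatResidual p w) :=
  (isL1Bilinear_heatLhs hb).sub (isL1Bilinear_heatRhs hb)

theorem isL1Bilinear_microResidual (hb : κ.Bounded Ω) (i : Fin 3) : IsL1Bilinear (vol Ω)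
    (fun (p : State Ω × State Ω) (w : W0 Ω) => κ.microResidual i p w) :=
  (isL1Bilinear_microLhs hb i).sub (isL1Bilinear_microRhs hb i)

theorem isL1Bilinear_weakDensity (hb : κ.Bounded Ω) : IsL1Bilinear (vol Ω)
    (fun (p : State Ω × State Ω) (w : Vel Ω) => κ.weakDensity p w) :=
  .add (.add
    (.sum _ fun i => (isL1Bilinear_momentumResidual hb i).comp .id (isBoundedLinearMap_vel_u i))
    ((isL1Bilinear_heatResidual hb).comp .id isBoundedLinearMap_vel_τ))
    (.sum _ fun i => (isL1Bilinear_microResidual hb i).comp .id (isBoundedLinearMap_vel_R i))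

theorem integral_weakDensity (hb : κ.Bounded Ω) (p : State Ω × State Ω) (w : Vel Ω) :
    ∫ x in (Ω : Set E3), κ.weakDensity p w x
      = (∑ i, ∫ x in (Ω : Set E3), κ.momentumResidual i p (w.1 i) x)
        + (∫ x in (Ω : Set E3), κ.heatResidual p w.2.1 x)
        + ∑ i, ∫ x in (Ω : Set E3), κ.microResidual i p (w.2.2 i) x := by
  have h1 : ∀ i, Integrable (κ.momentumResidual i p (w.1 i)) (vol Ω) := fun i =>
    (isL1Bilinear_momentumResidual hb i).integrable p (w.1 i)
  have h2 : Integrable (κ.heatResidual p w.2.1) (vol Ω) :=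
    (isL1Bilinear_heatResidual hb).integrable p w.2.1
  have h3 : ∀ i, Integrable (κ.microResidual i p (w.2.2 i)) (vol Ω) := fun i =>
    (isL1Bilinear_microResidual hb i).integrable p (w.2.2 i)
  have h1' : Integrable (fun x => ∑ i, κ.momentumResidual i p (w.1 i) x) (vol Ω) :=
    integrable_finsetSum _ fun i _ => h1 i
  have h3' : Integrable (fun x => ∑ i, κ.microResidual i p (w.2.2 i) x) (vol Ω) :=
    integrable_finsetSum _ fun i _ => h3 i
  have h12 : Integrable (fun x => (∑ i, κ.momentumResidual i p (w.1 i) x)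
      + κ.heatResidual p w.2.1 x) (vol Ω) := h1'.add h2
  simp only [weakDensity]
  rw [integral_add h12 h3', integral_add h1' h2, integral_finsetSum _ fun i _ => h1 i,
    integral_finsetSum _ fun i _ => h3 i]

/-- Enlarging the class of test functions to `W₀^{1,2}` is what permits testing with the velocities,
which need not be smooth. -/
theorem row_v_iff (hb : κ.Bounded Ω) (U V : State Ω) (i : Fin 3) :
    (∀ φ : 𝓓(Ω, ℝ), ∫ x in (Ω : Set E3), κ.ρ x * V.v i x * φ x =
      -∫ x in (Ω : Set E3), ∑ j,
        ((∑ k, ∑ l, κ.A j i k l x * (U.u k).d l x) - κ.a j i x * U.θ x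
          + ∑ k, ∑ l, κ.B j i k l x * (U.R l).d k x) * pderiv j φ x) ↔
    ∀ w, ∫ x in (Ω : Set E3), κ.momentumResidual i (U, V) w x = 0 := by
  simp only [← integral_neg]
  refine forall_test_iff (isL1Bilinear_momentumLhs hb i) (isL1Bilinear_momentumRhs hb i)
    (fun φ => ?_) (fun φ => ?_)
  · filter_upwards [coeFn_testJet_fn φ] with x h1
    simp only [momentumLhs, h1]
  · filter_upwards [ae_all_iff.mpr (coeFn_testJet_d φ)] with x h1
    simp only [momentumRhs, h1]

theorem row_θ_iff (hb : κ.Bounded Ω) (U V : State Ω) :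
    (∀ φ : 𝓓(Ω, ℝ), ∫ x in (Ω : Set E3), κ.c x * V.θ x * φ x =
      ∫ x in (Ω : Set E3),
        (-(∑ i, ∑ j, κ.a i j x * (V.u i).d j x) * φ x
          - (∑ i, ∑ j, (κ.K i j x * U.τ.d j x + κ.Kt i j x * V.τ.d j x
              - κ.d i j x * U.M j x) * pderiv i φ x)
          - (∑ i, ∑ j, κ.b j i x * (V.R i).d j x) * φ x)) ↔
    ∀ w, ∫ x in (Ω : Set E3), κ.heatResidual (U, V) w x = 0 := by
  refine forall_test_iff (isL1Bilinear_heatLhs (Ω := Ω) hb) (isL1Bilinear_heatRhs (Ω := Ω) hb)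
    (p := (U, V)) (fun φ => ?_) (fun φ => ?_)
  · filter_upwards [coeFn_testJet_fn φ] with x h1
    simp only [heatLhs, h1]
  · filter_upwards [coeFn_testJet_fn φ, ae_all_iff.mpr (coeFn_testJet_d φ)] with x h1 h2
    simp only [heatRhs, h1, h2]

theorem row_M_iff (hb : κ.Bounded Ω) (U V : State Ω) (i : Fin 3) :
    (∀ φ : 𝓓(Ω, ℝ), ∫ x in (Ω : Set E3), (∑ j, κ.cT i j x * V.M j x) * φ x =
      ∫ x in (Ω : Set E3),
        (-(∑ j, ((∑ k, ∑ l, κ.B k l j i x * (U.u k).d l x) - κ.b j i x * U.θ x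
              + (∑ k, ∑ l, κ.C j i k l x * (U.R k).d l x)
              + ∑ k, ∑ l, κ.Ct j i k l x * (V.R k).d l x) * pderiv j φ x)
          - (∑ j, κ.d i j x * V.τ.d j x) * φ x)) ↔
    ∀ w, ∫ x in (Ω : Set E3), κ.microResidual i (U, V) w x = 0 := by
  refine forall_test_iff (isL1Bilinear_microLhs hb i) (isL1Bilinear_microRhs hb i)
    (fun φ => ?_) (fun φ => ?_)
  · filter_upwards [coeFn_testJet_fn φ] with x h1
    simp only [microLhs, h1]
  · filter_upwards [coeFn_testJet_fn φ, ae_all_iff.mpr (coeFn_testJet_d φ)] with x h1 h2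
    simp only [microRhs, h1, h2]

/-- The weak formulation of the graph of the operator. -/
theorem opGraph_iff (hb : κ.Bounded Ω) (U V : State Ω) :
    κ.OpGraph U V ↔ ((∀ i, (V.u i).fn = U.v i) ∧ V.τ.fn = U.θ ∧ ∀ i, (V.R i).fn = U.M i) ∧
      ∀ w : Vel Ω, ∫ x in (Ω : Set E3), κ.weakDensity (U, V) w x = 0 := by
  constructor
  · intro h
    refine ⟨⟨h.row_u, h.row_τ, h.row_R⟩, fun w => ?_⟩
    rw [integral_weakDensity hb, (row_θ_iff hb U V).mp h.row_θ]
    simp only [fun i => (row_v_iff hb U V i).mp (h.row_v i), fun i =>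
      (row_M_iff hb U V i).mp (h.row_M i), Finset.sum_const_zero, add_zero]
  · rintro ⟨⟨hu, hτ, hR⟩, h⟩
    have z1 : ∀ i, ∫ x in (Ω : Set E3), κ.momentumResidual i (U, V) 0 x = 0 := fun i =>
      (isL1Bilinear_momentumResidual hb i).integral_zero_right (U, V)
    have z2 : ∫ x in (Ω : Set E3), κ.heatResidual (U, V) 0 x = 0 :=
      (isL1Bilinear_heatResidual hb).integral_zero_right (U, V)
    have z3 : ∀ i, ∫ x in (Ω : Set E3), κ.microResidual i (U, V) 0 x = 0 := fun i =>
      (isL1Bilinear_microResidual hb i).integral_zero_right (U, V)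
    refine ⟨hu, fun i => (row_v_iff hb U V i).mpr fun w => ?_, hτ,
      (row_θ_iff hb U V).mpr fun w => ?_, hR, fun i => (row_M_iff hb U V i).mpr fun w => ?_⟩
    · have h1 := h (Pi.single i w, 0, 0)
      rw [integral_weakDensity hb, Finset.sum_eq_single_of_mem i (Finset.mem_univ i)
        (fun j _ hj => by simp only [Pi.single_eq_of_ne hj, z1])] at h1
      simpa only [Pi.single_eq_same, Pi.zero_apply, z2, z3, Finset.sum_const_zero, add_zero]
        using h1
    · have h1 := h (0, w, 0)
      rw [integral_weakDensity hb] at h1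
      simpa only [Pi.zero_apply, z1, z3, Finset.sum_const_zero, add_zero, zero_add] using h1
    · have h1 := h (0, 0, Pi.single i w)
      rw [integral_weakDensity hb, Finset.sum_eq_single_of_mem (s := Finset.univ)
        (f := fun j => ∫ x in (Ω : Set E3), κ.microResidual j (U, V)
          ((Pi.single i w : Fin 3 → W0 Ω) j) x) i (Finset.mem_univ i)
        (fun j _ hj => by simp only [Pi.single_eq_of_ne hj, z3])] at h1
      simpa only [Pi.single_eq_same, Pi.zero_apply, z1, z2, Finset.sum_const_zero, zero_add]
        using h1

/-- The energy identity: testing the weak form with the velocities. -/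
theorem two_energyInner_le (hb : κ.Bounded Ω) (hs : κ.Symmetric Ω) (hd : κ.Dissipative Ω)
    {U V : State Ω} (hu : ∀ i, (V.u i).fn = U.v i) (hτ : V.τ.fn = U.θ)
    (hR : ∀ i, (V.R i).fn = U.M i) :
    2 * κ.energyInner V U
      ≤ ∫ x in (Ω : Set E3), κ.weakDensity (U, V) (V.u, V.τ, V.R) x := by
  have h1 : 2 * κ.energyInner V U = ∫ x in (Ω : Set E3), κ.energyDensity V U x := by
    rw [energyInner_eq]; ring
  rw [h1]
  refine integral_mono_ae ((isL1Bilinear_energyDensity hb).integrable V U)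
    ((isL1Bilinear_weakDensity hb).integrable (U, V) (V.u, V.τ, V.R)) ?_
  filter_upwards [hs, hd] with x hx hdx
  have hs4 := fun i j k l => (hx i j).2.2.2.2.2.2 k l
  have key := power_balance (ρ := κ.ρ x) (c := κ.c x) (a := fun i j => κ.a i j x)
    (b := fun i j => κ.b i j x) (d := fun i j => κ.d i j x) (cT := fun i j => κ.cT i j x)
    (K := fun i j => κ.K i j x) (Kt := fun i j => κ.Kt i j x)
    (A := fun i j k l => κ.A i j k l x) (B := fun i j k l => κ.B i j k l x)
    (C := fun i j k l => κ.C i j k l x) (Ct := fun i j k l => κ.Ct i j k l x)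
    (fun i j => (hx i j).1) (fun i j => (hx i j).2.2.1) (fun i j => (hx i j).2.2.2.1)
    (fun i j k l => (hs4 i j k l).1) (fun i j k l => (hs4 i j k l).2.1)
    (fun i j k l => (hs4 i j k l).2.2.1) (fun i j k l => (hs4 i j k l).2.2.2.1)
    (fun i j k l => (hs4 i j k l).2.2.2.2.1)
    (fun i => U.v i x) (fun i => V.v i x) (fun i => U.M i x) (fun i => V.M i x)
    (U.θ x) (V.θ x) (du := fun i j => (U.u i).d j x) (dR := fun i j => (U.R i).d j x)
    (dv := fun i j => (V.u i).d j x) (dm := fun i j => (V.R i).d j x)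
    (eu := fun i j => strain U.u i j x) (ev := fun i j => strain V.u i j x)
    (fun j => U.τ.d j x) (fun j => V.τ.d j x) (fun _ _ => rfl) (fun _ _ => rfl)
  -- The matrix is the transposed gradient, `G i j = M_{j,i}`: then `C̃_{ijkl} G_{lk} G_{ij} =
  -- C̃_{ijkl} M_{k,l} M_{j,i}`, the work of the microflux after relabelling.
  have hdx' := hdx (fun j => V.τ.d j x) (fun i j => (V.R j).d i x)
  simp only [weakDensity, momentumResidual, heatResidual, microResidual, momentumLhs, momentumRhs,
    heatLhs, heatRhs, microLhs, microRhs, hu, hτ, hR]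
  refine le_trans ?_ key.ge
  exact le_add_of_nonneg_right hdx'

end Coefficients

end WeakForm

/-! ### Bounded maps into products and pull-backs of inner products. -/

section Products

variable {A B C D E F Y : Type*} [NormedAddCommGroup A] [NormedSpace ℝ A] [NormedAddCommGroup B]
  [NormedSpace ℝ B] [NormedAddCommGroup C] [NormedSpace ℝ C] [NormedAddCommGroup D]
  [NormedSpace ℝ D] [NormedAddCommGroup E] [NormedSpace ℝ E] [NormedAddCommGroup F]
  [NormedSpace ℝ F] [NormedAddCommGroup Y] [NormedSpace ℝ Y]

theorem isBoundedLinearMap_prodMk {f : Y → A} {g : Y → B} (hf : IsBoundedLinearMap ℝ f)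
    (hg : IsBoundedLinearMap ℝ g) : IsBoundedLinearMap ℝ (fun y => (f y, g y)) :=
  (hf.toContinuousLinearMap.prod hg.toContinuousLinearMap).isBoundedLinearMap

theorem isBoundedLinearMap_pi {ι : Type*} [Fintype ι] {f : ι → Y → A}
    (hf : ∀ i, IsBoundedLinearMap ℝ (f i)) : IsBoundedLinearMap ℝ (fun y i => f i y) :=
  (ContinuousLinearMap.pi fun i => (hf i).toContinuousLinearMap).isBoundedLinearMap

theorem isBoundedLinearMap_prod6 {f₁ : Y → A} {f₂ : Y → B} {f₃ : Y → C} {f₄ : Y → D} {f₅ : Y → E}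
    {f₆ : Y → F} (h₁ : IsBoundedLinearMap ℝ f₁) (h₂ : IsBoundedLinearMap ℝ f₂)
    (h₃ : IsBoundedLinearMap ℝ f₃) (h₄ : IsBoundedLinearMap ℝ f₄) (h₅ : IsBoundedLinearMap ℝ f₅)
    (h₆ : IsBoundedLinearMap ℝ f₆) :
    IsBoundedLinearMap ℝ (fun y => (f₁ y, f₂ y, f₃ y, f₄ y, f₅ y, f₆ y)) :=
  isBoundedLinearMap_prodMk h₁ (isBoundedLinearMap_prodMk h₂ (isBoundedLinearMap_prodMk h₃
    (isBoundedLinearMap_prodMk h₄ (isBoundedLinearMap_prodMk h₅ h₆))))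

theorem isBoundedLinearMap_graph_smul {f : Y → A} (hf : IsBoundedLinearMap ℝ f) (l : ℝ) :
    IsBoundedLinearMap ℝ (fun y => (f y, l • f y)) :=
  isBoundedLinearMap_prodMk hf (hf.smul l)

omit [NormedSpace ℝ A] [NormedSpace ℝ B] [NormedSpace ℝ C] [NormedSpace ℝ D] [NormedSpace ℝ E]
  [NormedSpace ℝ F] in
theorem norm_triple_le_norm_prod6 (x : A × B × C × D × E × F) :
    ‖(x.1, x.2.2.1, x.2.2.2.2.1)‖ ≤ ‖x‖ := by
  obtain ⟨a, b, c, d, e, f⟩ := x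
  simp only [Prod.norm_mk]
  refine max_le (le_max_left _ _) (max_le ?_ ?_)
  · exact le_max_of_le_right (le_max_of_le_right (le_max_left _ _))
  · exact le_max_of_le_right (le_max_of_le_right (le_max_of_le_right (le_max_of_le_right
      (le_max_left _ _))))

omit [NormedSpace ℝ A] [NormedSpace ℝ B] [NormedSpace ℝ C] [NormedSpace ℝ D] [NormedSpace ℝ E]
  [NormedSpace ℝ F] in
theorem norm_triple_embed (w : A × C × E) :
    ‖((w.1, 0, w.2.1, 0, w.2.2, 0) : A × B × C × D × E × F)‖ = ‖w‖ := by
  obtain ⟨a, c, e⟩ := w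
  simp [Prod.norm_mk]

/-- The pull-back of an equivalent inner product along a linear isometry. -/
theorem IsEquivalentInner.comp {b : A → A → ℝ} (h : IsEquivalentInner b) {p : Y → A}
    (hadd : ∀ x y, p (x + y) = p x + p y) (hsmul : ∀ (r : ℝ) x, p (r • x) = r • p x)
    (hnorm : ∀ x, ‖p x‖ = ‖x‖) : IsEquivalentInner (fun x y => b (p x) (p y)) where
  symm := fun x y => h.symm _ _
  add_left := fun x y z => by rw [hadd, h.add_left]
  smul_left := fun r x y => by rw [hsmul, h.smul_left]
  equiv := by
    obtain ⟨m, hm, M, hM, hb⟩ := h.equiv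
    exact ⟨m, hm, M, hM, fun x => by simpa only [hnorm] using hb (p x)⟩

end Products

/-! ### Dissipativity, the resolvent equation and single-valuedness. -/

section Generation

variable {Ω : Opens E3}

/-- A triple of displacements, as a state at rest. -/
def restState (w : Vel Ω) : State Ω := (w.1, 0, w.2.1, 0, w.2.2, 0)

theorem restState_add (w w' : Vel Ω) : restState (w + w') = restState w + restState w' := by
  simp only [restState, Prod.fst_add, Prod.snd_add, Prod.mk_add_mk, add_zero]

theorem restState_smul (r : ℝ) (w : Vel Ω) : restState (r • w) = r • restState w := by
  simp only [restState, Prod.smul_fst, Prod.smul_snd, Prod.smul_mk, smul_zero]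

theorem norm_restState (w : Vel Ω) : ‖restState w‖ = ‖w‖ :=
  norm_triple_embed (A := Fin 3 → W0 Ω) (B := Fin 3 → L2 Ω) (C := W0 Ω) (D := L2 Ω)
    (E := Fin 3 → W0 Ω) (F := Fin 3 → L2 Ω) w

/-- The state with velocities `w` and displacements `r w`. -/
def velState (r : ℝ) (w : Vel Ω) : State Ω :=
  (r • w.1, fun i => (w.1 i).fn, r • w.2.1, w.2.1.fn, r • w.2.2, fun i => (w.2.2 i).fn)

theorem isBoundedLinearMap_fn : IsBoundedLinearMap ℝ (fun w : W0 Ω => w.fn) :=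
  (fnL Ω).isBoundedLinearMap

theorem isBoundedLinearMap_velState (r : ℝ) :
    IsBoundedLinearMap ℝ (fun w : Vel Ω => velState r w) := by
  have h1 : IsBoundedLinearMap ℝ (fun w : Vel Ω => w.1) := .fst
  have h2 : IsBoundedLinearMap ℝ (fun w : Vel Ω => w.2.1) := isBoundedLinearMap_vel_τ
  have h3 : IsBoundedLinearMap ℝ (fun w : Vel Ω => w.2.2) :=
    .comp (g := fun w : W0 Ω × (Fin 3 → W0 Ω) => w.2) .snd .snd
  have h4' : ∀ i, IsBoundedLinearMap ℝ (fun w : Vel Ω => (w.1 i).fn) := fun i =>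
    .comp (g := fun w : W0 Ω => w.fn) (isBoundedLinearMap_fn (Ω := Ω))
      (isBoundedLinearMap_vel_u (Ω := Ω) i)
  have h4 : IsBoundedLinearMap ℝ (fun (w : Vel Ω) (i : Fin 3) => (w.1 i).fn) :=
    isBoundedLinearMap_pi (A := L2 Ω) (Y := Vel Ω) (f := fun i w => (w.1 i).fn) h4'
  have h5 : IsBoundedLinearMap ℝ (fun w : Vel Ω => w.2.1.fn) :=
    .comp (g := fun w : W0 Ω => w.fn) (isBoundedLinearMap_fn (Ω := Ω)) h2
  have h6' : ∀ i, IsBoundedLinearMap ℝ (fun w : Vel Ω => (w.2.2 i).fn) := fun i =>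
    .comp (g := fun w : W0 Ω => w.fn) (isBoundedLinearMap_fn (Ω := Ω))
      (isBoundedLinearMap_vel_R (Ω := Ω) i)
  have h6 : IsBoundedLinearMap ℝ (fun (w : Vel Ω) (i : Fin 3) => (w.2.2 i).fn) :=
    isBoundedLinearMap_pi (A := L2 Ω) (Y := Vel Ω) (f := fun i w => (w.2.2 i).fn) h6'
  exact isBoundedLinearMap_prod6 (A := Fin 3 → W0 Ω) (B := Fin 3 → L2 Ω) (C := W0 Ω) (D := L2 Ω)
    (E := Fin 3 → W0 Ω) (F := Fin 3 → L2 Ω) (Y := Vel Ω) (h1.smul r) h4 (h2.smul r) h5 (h3.smul r) h6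

/-- The displacement components of this state are `w / l`, and they alone bound its maximum norm
from below. -/
theorem norm_le_velState {l : ℝ} (hl : 0 < l) (w : Vel Ω) : ‖w‖ ≤ l * ‖velState l⁻¹ w‖ := by
  set x := velState l⁻¹ w
  have h1 : w = l • (x.1, x.2.2.1, x.2.2.2.2.1) := by
    change w = l • (l⁻¹ • w)
    rw [smul_inv_smul₀ hl.ne']
  have h2 : ‖(x.1, x.2.2.1, x.2.2.2.2.1)‖ ≤ ‖x‖ :=
    norm_triple_le_norm_prod6 (A := Fin 3 → W0 Ω) (B := Fin 3 → L2 Ω) (C := W0 Ω) (D := L2 Ω)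
      (E := Fin 3 → W0 Ω) (F := Fin 3 → L2 Ω) x
  calc ‖w‖ = l * ‖(x.1, x.2.2.1, x.2.2.2.2.1)‖ := by
        rw [h1, norm_smul, Real.norm_of_nonneg hl.le]
    _ ≤ l * ‖x‖ := by gcongr

namespace Coefficients

variable {κ : Coefficients}

/-- On the graph the weak form vanishes, and it dominates twice the energy product, the gap being
the integrated dissipation. -/
theorem energyInner_nonpos (hb : κ.Bounded Ω) (hs : κ.Symmetric Ω) (hd : κ.Dissipative Ω)
    {U V : State Ω} (h : κ.OpGraph U V) : κ.energyInner V U ≤ 0 := by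
  obtain ⟨⟨hu, hτ, hR⟩, hw⟩ := (opGraph_iff hb U V).mp h
  have := two_energyInner_le hb hs hd hu hτ hR
  rw [hw] at this
  linarith

/-- The graph of the operator, as a linear subspace. -/
def graph (κ : Coefficients) (hb : κ.Bounded Ω) : Submodule ℝ (State Ω × State Ω) where
  carrier := {p | κ.OpGraph p.1 p.2}
  zero_mem' := by
    refine (opGraph_iff hb _ _).mpr ⟨⟨fun _ => rfl, rfl, fun _ => rfl⟩, fun w => ?_⟩
    have := (isL1Bilinear_weakDensity hb).integral_smul_left 0 ((0, 0) : State Ω × State Ω) w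
    rwa [zero_smul, zero_mul] at this
  add_mem' := by
    intro p q hp hq
    obtain ⟨⟨hu, hτ, hR⟩, hw⟩ := (opGraph_iff hb _ _).mp hp
    obtain ⟨⟨hu', hτ', hR'⟩, hw'⟩ := (opGraph_iff hb _ _).mp hq
    refine (opGraph_iff hb _ _).mpr ⟨⟨fun i => ?_, ?_, fun i => ?_⟩, fun w => ?_⟩
    · exact ((fnL Ω).map_add _ _).trans (congrArg₂ (· + ·) (hu i) (hu' i))
    · exact ((fnL Ω).map_add _ _).trans (congrArg₂ (· + ·) hτ hτ')
    · exact ((fnL Ω).map_add _ _).trans (congrArg₂ (· + ·) (hR i) (hR' i))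
    · have := (isL1Bilinear_weakDensity hb).integral_add_left p q w
      rw [hw, hw', add_zero] at this
      exact this
  smul_mem' := by
    intro r p hp
    obtain ⟨⟨hu, hτ, hR⟩, hw⟩ := (opGraph_iff hb _ _).mp hp
    refine (opGraph_iff hb _ _).mpr ⟨⟨fun i => ?_, ?_, fun i => ?_⟩, fun w => ?_⟩
    · exact ((fnL Ω).map_smul r _).trans (congrArg (r • ·) (hu i))
    · exact ((fnL Ω).map_smul r _).trans (congrArg (r • ·) hτ)
    · exact ((fnL Ω).map_smul r _).trans (congrArg (r • ·) (hR i))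
    · have := (isL1Bilinear_weakDensity hb).integral_smul_left r p w
      rw [hw, mul_zero] at this
      exact this

/-- Supplies the Hilbert structure on `Vel Ω` that Lax–Milgram requires; the coercive form to which
it is applied is the weak form, not this product. -/
theorem isEquivalentInner_vel (h : IsEquivalentInner (fun U V : State Ω => κ.energyInner U V)) :
    IsEquivalentInner (fun w w' : Vel Ω => κ.energyInner (restState w) (restState w')) :=
  h.comp restState_add restState_smul norm_restState

/-- Coercivity of the weak form of the resolvent equation. -/
theorem weakDensity_coercive (hb : κ.Bounded Ω) (hs : κ.Symmetric Ω) (hd : κ.Dissipative Ω)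
    (h : IsEquivalentInner (fun U V : State Ω => κ.energyInner U V)) {l : ℝ} (hl : 0 < l) :
    ∃ m : ℝ, 0 < m ∧ ∀ w : Vel Ω, m * ‖w‖ ^ 2 ≤
      ∫ x in (Ω : Set E3), κ.weakDensity (velState l⁻¹ w, l • velState l⁻¹ w) w x := by
  obtain ⟨m, hm, _, _, hbd⟩ := h.equiv
  -- The state `l • U` has displacements `w`, so the energy inequality applies with `w` as test
  -- velocity and gives `2 l ⟨U, U⟩ ≥ 2 l m ‖U‖²`; finally `‖U‖ ≥ ‖w‖ / l`.
  refine ⟨2 * m / l, by positivity, fun w => ?_⟩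
  set U := velState l⁻¹ w with hU
  have e1 : (l • U).u = w.1 := smul_inv_smul₀ hl.ne' w.1
  have e2 : (l • U).τ = w.2.1 := smul_inv_smul₀ hl.ne' w.2.1
  have e3 : (l • U).R = w.2.2 := smul_inv_smul₀ hl.ne' w.2.2
  have h1 := two_energyInner_le hb hs hd (U := U) (V := l • U)
    (fun i => by rw [e1]; rfl) (by rw [e2]; rfl) (fun i => by rw [e3]; rfl)
  rw [e1, e2, e3] at h1
  have h2 : κ.energyInner (l • U) U = l * κ.energyInner U U := h.smul_left l U U
  have h3 : m * ‖U‖ ^ 2 ≤ κ.energyInner U U := (hbd U).1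
  have h4 : ‖w‖ ^ 2 ≤ l ^ 2 * ‖U‖ ^ 2 := by
    rw [← mul_pow]
    exact pow_le_pow_left₀ (norm_nonneg _) (norm_le_velState hl w) 2
  refine le_trans ?_ h1
  rw [h2]
  calc 2 * m / l * ‖w‖ ^ 2 ≤ 2 * m / l * (l ^ 2 * ‖U‖ ^ 2) := by gcongr
    _ = 2 * (l * (m * ‖U‖ ^ 2)) := by field_simp
    _ ≤ 2 * (l * κ.energyInner U U) := by gcongr

/-- Solvability of the resolvent equation. -/
theorem exists_resolvent (hb : κ.Bounded Ω) (hs : κ.Symmetric Ω) (hd : κ.Dissipative Ω)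
    (h : IsEquivalentInner (fun U V : State Ω => κ.energyInner U V)) {l : ℝ} (hl : 0 < l)
    (F : State Ω) : ∃ U V : State Ω, κ.OpGraph U V ∧ l • U - V = F := by
  obtain ⟨m, hm, hco⟩ := weakDensity_coercive hb hs hd h hl
  have hpair : IsBoundedLinearMap ℝ
      (fun w : Vel Ω => (velState l⁻¹ w, l • velState l⁻¹ w)) :=
    isBoundedLinearMap_graph_smul (A := State Ω) (Y := Vel Ω)
      (isBoundedLinearMap_velState (Ω := Ω) l⁻¹) l
  have hid : IsBoundedLinearMap ℝ (fun w : Vel Ω => w) := .id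
  have hwd := isL1Bilinear_weakDensity (Ω := Ω) hb
  have hF : IsL1Bilinear (vol Ω) (fun w w' : Vel Ω =>
      κ.weakDensity (velState l⁻¹ w, l • velState l⁻¹ w) w') := hwd.comp hpair hid
  -- A particular solution of the displacement rows with zero velocities. The remainder `velState
  -- l⁻¹ w` solves their homogeneous version, so all data pass into `q`.
  set U₁ : State Ω := (l⁻¹ • F.u, 0, l⁻¹ • F.τ, 0, l⁻¹ • F.R, 0) with hU₁
  set q : State Ω × State Ω := (U₁, l • U₁ - F) with hq
  -- By linearity of the weak form in the pair, the sum of the homogeneous pair and `q` must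
  -- annihilate every test velocity, hence the right-hand side `-q`.
  obtain ⟨w, hw⟩ := IsL1Bilinear.exists_forall_integral_eq (isEquivalentInner_vel h) hF hm hco
    hwd ((-1 : ℝ) • q)
  set U := velState l⁻¹ w + U₁ with hU
  refine ⟨U, l • U - F, (opGraph_iff hb _ _).mpr ⟨?_, fun w' => ?_⟩, sub_sub_cancel _ _⟩
  · have e : ∀ {X : Type} [AddCommGroup X] [Module ℝ X] (a f : X),
        l • (l⁻¹ • a + l⁻¹ • f) - f = a := by
      intro X _ _ a f
      rw [← smul_add, smul_inv_smul₀ hl.ne', add_sub_cancel_right]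
    have e1 : (l • U - F).u = w.1 := e w.1 F.u
    have e2 : (l • U - F).τ = w.2.1 := e w.2.1 F.τ
    have e3 : (l • U - F).R = w.2.2 := e w.2.2 F.R
    rw [e1, e2, e3]
    exact ⟨fun i => (add_zero _).symm, (add_zero _).symm, fun i => (add_zero _).symm⟩
  · have e : (U, l • U - F) = (velState l⁻¹ w, l • velState l⁻¹ w) + q := by
      rw [hq, Prod.mk_add_mk, hU, smul_add, add_sub_assoc]
    have e1 := hwd.integral_add_left (velState l⁻¹ w, l • velState l⁻¹ w) q w'
    have e2 := hwd.integral_smul_left (-1) q w'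
    have e3 := (hw w').trans e2
    rw [e]
    refine e1.trans ?_
    rw [e3]
    ring

/-- The operator is single-valued. -/
theorem eq_zero_of_opGraph_zero (hb : κ.Bounded Ω) (hp : κ.Positive Ω) {V : State Ω}
    (h : κ.OpGraph 0 V) : V = 0 := by
  -- The kinematic rows equate functions only; `eq_zero_of_fn_eq_zero` makes the gradients vanish as
  -- well, so the right-hand sides of the other rows are zero.
  have hu : V.u = 0 := funext fun i => eq_zero_of_fn_eq_zero (h.row_u i)
  have hτ : V.τ = 0 := eq_zero_of_fn_eq_zero h.row_τ
  have hR : V.R = 0 := funext fun i => eq_zero_of_fn_eq_zero (h.row_R i)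
  obtain ⟨γ, hγ, hpos⟩ := hp
  have z0 : ((0 : L2 Ω) : E3 → ℝ) =ᵐ[vol Ω] 0 := Lp.coeFn_zero ℝ 2 (vol Ω)
  have zu : ∀ i j, (((0 : State Ω).u i).d j) = 0 := fun _ _ => rfl
  have zR : ∀ i j, (((0 : State Ω).R i).d j) = 0 := fun _ _ => rfl
  have zτ : ∀ j, (0 : State Ω).τ.d j = 0 := fun _ => rfl
  have zθ : (0 : State Ω).θ = 0 := rfl
  have zM : ∀ j, (0 : State Ω).M j = 0 := fun _ => rfl
  have zVu : ∀ i j, (V.u i).d j = 0 := fun _ _ => by rw [hu]; rfl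
  have zVR : ∀ i j, (V.R i).d j = 0 := fun _ _ => by rw [hR]; rfl
  have zVτ : ∀ j, V.τ.d j = 0 := fun _ => by rw [hτ]; rfl
  have hv : V.v = 0 := by
    funext i
    refine Lp.eq_zero_iff_ae_eq_zero.mpr ?_
    have h1 := ae_eq_zero_of_forall_test (f := fun x => κ.ρ x * V.v i x)
      (((isL2Linear_v (Ω := Ω) i).Linfty_mul hb.ρ).memLp V) fun φ => by
        rw [h.row_v i φ, integral_eq_zero_of_ae, neg_zero]
        filter_upwards [z0] with x hx
        simp only [zu, zR, zθ, hx]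
        simp
    filter_upwards [h1, hpos] with x hx hx'
    exact (mul_eq_zero.mp hx).resolve_left (hγ.trans_le hx'.1).ne'
  have hθ : V.θ = 0 := by
    refine Lp.eq_zero_iff_ae_eq_zero.mpr ?_
    have h1 := ae_eq_zero_of_forall_test (f := fun x => κ.c x * V.θ x)
      (((isL2Linear_θ (Ω := Ω)).Linfty_mul hb.c).memLp V) fun φ => by
        rw [h.row_θ φ, integral_eq_zero_of_ae]
        filter_upwards [z0] with x hx
        simp only [zτ, zM, zVu, zVR, zVτ, hx]
        simp
    filter_upwards [h1, hpos] with x hx hx'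
    exact (mul_eq_zero.mp hx).resolve_left (hγ.trans_le hx'.2.1).ne'
  have hM : V.M = 0 := by
    have h1 : ∀ i, (fun x => ∑ j, κ.cT i j x * V.M j x) =ᵐ[vol Ω] 0 := fun i =>
      ae_eq_zero_of_forall_test ((IsL2Linear.sum Finset.univ fun j =>
        (isL2Linear_M (Ω := Ω) j).Linfty_mul (hb.cT i j)).memLp V) fun φ => by
        rw [h.row_M i φ, integral_eq_zero_of_ae]
        filter_upwards [z0] with x hx
        simp only [zu, zR, zθ, zVR, zVτ, hx]
        simp
    funext i
    refine Lp.eq_zero_iff_ae_eq_zero.mpr ?_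
    filter_upwards [ae_all_iff.mpr h1, hpos] with x hx hx'
    -- The vector `c_{ij} M_j` vanishes; contracting it with `M` and using definiteness of `c_{ij}`
    -- gives `M = 0`.
    have h2 := hx'.2.2 fun i => V.M i x
    have h3 : ∑ i, ∑ j, κ.cT i j x * V.M i x * V.M j x = 0 := by
      refine Finset.sum_eq_zero fun i _ => ?_
      have h4 : ∑ j, κ.cT i j x * V.M i x * V.M j x
          = V.M i x * ∑ j, κ.cT i j x * V.M j x := by
        rw [Finset.mul_sum]
        exact Finset.sum_congr rfl fun j _ => by ring
      have h5 : ∑ j, κ.cT i j x * V.M j x = 0 := hx i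
      rw [h4, h5, mul_zero]
    rw [h3] at h2
    have h6 : ∑ i, V.M i x ^ 2 ≤ 0 := nonpos_of_mul_nonpos_right h2 hγ
    have h7 : V.M i x ^ 2 ≤ ∑ i, V.M i x ^ 2 :=
      Finset.single_le_sum (f := fun i => V.M i x ^ 2) (fun _ _ => sq_nonneg _)
        (Finset.mem_univ i)
    exact pow_eq_zero_iff two_ne_zero |>.mp (le_antisymm (h7.trans h6) (sq_nonneg _))
  exact Prod.ext hu (Prod.ext hv (Prod.ext hτ (Prod.ext hθ (Prod.ext hR hM))))

end Coefficients

end Generation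
end ThermoIII

end

open ThermoIII in
theorem theorem1 (Ω : TopologicalSpace.Opens E3) (hΩ : Bornology.IsBounded (Ω : Set E3))
    (κ : Coefficients) (hbdd : κ.Bounded Ω) (hpos : κ.Positive Ω)
    (hsym : κ.Symmetric Ω) (hdiss : κ.Dissipative Ω) (hcoer : κ.Coercive Ω) :
    IsEquivalentInner (fun U V : State Ω => κ.energyInner U V) ∧
    ∃ S : C0Semigroup (State Ω),
      (∀ t U, κ.energyNorm (S.T t U) ≤ κ.energyNorm U) ∧
      ∀ U V : State Ω, S.GenGraph U V ↔ κ.OpGraph U V := by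
  have h := Coefficients.isEquivalentInner_energyInner hΩ hbdd hpos hsym hcoer
  refine ⟨h, ?_⟩
  obtain ⟨S, hS, hgen⟩ := lumer_phillips h (κ.graph hbdd)
    (fun U V hUV => Coefficients.energyInner_nonpos hbdd hsym hdiss hUV)
    (fun l hl F => Coefficients.exists_resolvent hbdd hsym hdiss h hl F)
    (fun V hV => Coefficients.eq_zero_of_opGraph_zero hbdd hpos hV)
  exact ⟨S, fun t U => Real.sqrt_le_sqrt (hS t U), hgen⟩
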